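/- Let $\mathcal H$ be a complex Hilbert space, let $\hat H$ (the Hamiltonian) and $\hat V$ (the perturbation) be symmetric, possibly unbounded, operators on $\mathcal H$, and let a variational manifold of pure states be given near a point in local coordinates $x=(x^1,\dots,x^n)$ by a $C^2$ map $x\mapsto|\psi(x)\rangle\neq0$ on an open set $U\subset\mathbb R^n$, with $|\psi(x)\rangle$ in the domains of $\hat H$ and $\hat V$. Put $E(x)=\frac{\langle\psi(x)|\hat H|\psi(x)\rangle}{\langle\psi(x)|\psi(x)\rangle}$ and $V(x)=\frac{\langle\psi(x)|\hat V|\psi(x)\rangle}{\langle\psi(x)|\psi(x)\rangle}$ and assume that both are $C^2$ on $U$. Let $$|V_\mu\rangle=\partial_\mu|\psi\rangle-\tfrac{\langle\psi|\partial_\mu\psi\rangle}{\langle\psi|\psi\rangle}|\psi\rangle,\qquad \bm g_{\mu\nu}=\tfrac{2\,\mathrm{Re}\langle V_\mu|V_\nu\rangle}{\langle\psi|\psi\rangle},\qquad \bm\omega_{\mu\nu}=\tfrac{2\,\mathrm{Im}\langle V_\mu|V_\nu\rangle}{\langle\psi|\psi\rangle},$$ where the $|V_\mu(x)\rangle$ are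 assumed linearly independent over $\mathbb R$, and let $\bm\Omega$ be the inverse of $\bm\omega$ or, if $\bm\omega$ is degenerate, its Moore–Penrose pseudo-inverse with respect to $\bm g$. Let $x_0\in U$ be a local minimum of $E$ with positive definite Hessian $\partial\partial E(x_0)$, such that the rank of $\bm\omega$ is constant near $x_0$ (automatic if $\bm\omega(x_0)$ is non-degenerate). Let $\bm K=-\bm\Omega\,\partial\partial E$ at $x_0$. *Linear response on the manifold.* For $\varphi:\mathbb R\to\mathbb R$ continuous with compact support and small $\epsilon$, let $x_\epsilon(t)$ be the solution of the evolution projected by the Lagrangian action principle, $\dot x^\mu=-\bm\Omega^{\mu\nu}\partial_\nu\langle\hat H+\epsilon\varphi(t)\hat V\rangle$, with $x_\epsilon(t)=x_0$ for $t$ near $-\infty$ (for each $T$, taken on $(-\infty,T)$ for all sufficiently small $\epsilon$), and let $\delta V(t)=\frac{d}{d\epsilon}\big|_{\epsilon=0}V(x_\epsilon(t))$. The retarded Green's function is the tempered distribution $G^R$ with $$\int e^{\mathrm i\omega t}\,\delta V(t)\,dt=\tilde\varphi(\omega)\,G^R(\omega),\qquad \tilde\varphi(\omega)=\int e^{\mathrm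 i\omega t}\varphi(t)\,dt,$$ as tempered distributions in $\omega$, for all such $\varphi$, and the spectral function is $\mathcal A=-\frac1\pi\,\mathrm{Im}\,G^R$. *Eigenvectors.* A complete normalized eigensystem is a finite family of $\omega_\ell\in\mathbb R\setminus\{0\}$ and $\mathcal E_\ell=\mathcal E(\mathrm i\omega_\ell)\in\mathbb C^n$ with $\bm K\mathcal E_\ell=\mathrm i\omega_\ell\mathcal E_\ell$ and ${\mathcal E_\ell^\mu}^*\bm\omega_{\mu\nu}\mathcal E_m^\nu=\mathrm i\,\mathrm{sgn}(\omega_\ell)\,\delta_{\ell m}$, whose span contains all eigenvectors of $\bm K$ in $\mathbb C^n$ with non-zero eigenvalue (so frequencies are repeated according to multiplicity). Then: 1. There is a complete normalized eigensystem that consists of pairs $(\omega_\ell,\mathcal E_\ell)$, $(-\omega_\ell,\mathcal E_\ell^*)$ with $\omega_\ell>0$. 2. The linear responses exist, $G^R$ exists and is unique (and hence so is the spectral function $\mathcal A$). 3. For every complete normalized eigensystem, $$\mathcal A(\omega)=\mathrm{sgn}(\omega)\sum_\ell\big|\mathcal E^\mu(\mathrm i\omega_\ell)\,\partial_\mu V\big|^2\,\delta(\omega-\omega_\ell),$$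 where $\partial_\mu V$ is evaluated at $x_0$. 4. $\mathrm{sgn}\,\mathcal A(\omega)=\mathrm{sgn}\,\omega$ on the support of $\mathcal A$: the support does not contain $0$, and for a test function $\theta\ge0$, $\mathcal A(\theta)\ge0$ if $\theta=0$ on $(-\infty,0]$ and $\mathcal A(\theta)\le0$ if $\theta=0$ on $[0,\infty)$, with strict inequality if moreover $\theta\neq0$ at some point of the support of $\mathcal A$. -/

import Mathlib

open scoped SchwartzMap

namespace VariationalResponse

open Filter Topology MeasureTheory

noncomputable section

/-! ### The Moore-Penrose inverse with respect to a metric -/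

section PseudoInverse

variable {n : ℕ}

/-- `W` is the Moore-Penrose pseudo-inverse of the bilinear form `w` with respect to the metric `g`:
the four Penrose conditions, where `W * w` and `w * W` have to be self-adjoint with respect to `g`
(on vectors) and to `g⁻¹` (on covectors). If `g = 1` these are the usual conditions, and they are
invariant under changes of basis. -/
structure IsPseudoInverse (g w W : Matrix (Fin n) (Fin n) ℝ) : Prop where
  inner_inverse : w * W * w = w
  outer_inverse : W * w * W = W
  symm_left : (g * (W * w)).IsSymm
  symm_right : (g⁻¹ * (w * W)).IsSymm

/-- The Moore-Penrose pseudo-inverse of `w` with respect to `g`. By `exists_isPseudoInverse` and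
`IsPseudoInverse.unique` this is the one matrix with `IsPseudoInverse g w W` whenever `g` is
positive definite. -/
def pseudoInverse (g w : Matrix (Fin n) (Fin n) ℝ) : Matrix (Fin n) (Fin n) ℝ :=
  Classical.epsilon (IsPseudoInverse g w)

open scoped MatrixOrder Matrix.Norms.L2Operator in
theorem exists_isPseudoInverse {g : Matrix (Fin n) (Fin n) ℝ} (hg : g.PosDef)
    (w : Matrix (Fin n) (Fin n) ℝ) : ∃ W, IsPseudoInverse g w W := by
  have key : ∀ M : Matrix (Fin n) (Fin n) ℝ, ∃ N : Matrix (Fin n) (Fin n) ℝ,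
      M * N * M = M ∧ N * M * N = N ∧ (N * M).IsSymm ∧ (M * N).IsSymm := by
    intro M
    have hP : (M.transpose * M).IsHermitian := by
      simp [Matrix.IsHermitian, Matrix.conjTranspose_eq_transpose_of_trivial, Matrix.transpose_mul]
    obtain ⟨Q, d, hQ, hQ', hPd⟩ : ∃ (Q : Matrix (Fin n) (Fin n) ℝ) (d : Fin n → ℝ),
        Q.transpose * Q = 1 ∧ Q * Q.transpose = 1 ∧
          M.transpose * M = Q * Matrix.diagonal d * Q.transpose := by
      refine ⟨(hP.eigenvectorUnitary : Matrix (Fin n) (Fin n) ℝ), hP.eigenvalues, ?_, ?_, ?_⟩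
      · have := Unitary.coe_star_mul_self hP.eigenvectorUnitary
        simpa [Matrix.star_eq_conjTranspose, Matrix.conjTranspose_eq_transpose_of_trivial] using this
      · have := Unitary.coe_mul_star_self hP.eigenvectorUnitary
        simpa [Matrix.star_eq_conjTranspose, Matrix.conjTranspose_eq_transpose_of_trivial] using this
      · have := hP.spectral_theorem
        simpa [Unitary.conjStarAlgAut_apply, Matrix.star_eq_conjTranspose,
          Matrix.conjTranspose_eq_transpose_of_trivial, Function.comp_def] using this
    set P := M.transpose * M with hPdef
    set B := Q * Matrix.diagonal (fun i => (d i)⁻¹) * Q.transpose with hB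
    have mulQ : ∀ a b : Fin n → ℝ, (Q * Matrix.diagonal a * Q.transpose) *
        (Q * Matrix.diagonal b * Q.transpose) =
          Q * Matrix.diagonal (fun i => a i * b i) * Q.transpose := by
      intro a b
      calc _ = Q * Matrix.diagonal a * (Q.transpose * Q) * Matrix.diagonal b * Q.transpose := by
            simp only [Matrix.mul_assoc]
        _ = _ := by rw [hQ, Matrix.mul_one, Matrix.mul_assoc Q, Matrix.diagonal_mul_diagonal]
    have symQ : ∀ a : Fin n → ℝ, (Q * Matrix.diagonal a * Q.transpose).transpose =
        Q * Matrix.diagonal a * Q.transpose := by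
      intro a
      simp [Matrix.transpose_mul, Matrix.mul_assoc]
    have hdd : ∀ a : ℝ, a * a⁻¹ * a = a := fun a => by
      by_cases h : a = 0
      · simp [h]
      · field_simp
    have hdd' : ∀ a : ℝ, a⁻¹ * a * a⁻¹ = a⁻¹ := fun a => by
      by_cases h : a = 0
      · simp [h]
      · field_simp
    have hBsym : B.transpose = B := symQ _
    have hBP : B * P = Q * Matrix.diagonal (fun i => (d i)⁻¹ * d i) * Q.transpose := by
      rw [hB, hPd, mulQ]
    have hPBP : P * B * P = P := by
      rw [Matrix.mul_assoc, hBP, hPd, mulQ]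
      simp only [← mul_assoc, hdd]
    have hBPB : B * P * B = B := by
      rw [hBP, hB, mulQ]
      simp only [hdd']
    have hBPsym : (B * P).transpose = B * P := by rw [hBP, symQ]
    have hPsym : P.transpose = P := by rw [hPd, symQ]
    have hPB : P * B = B * P := by
      have h := hBPsym
      rwa [Matrix.transpose_mul, hBsym, hPsym] at h
    have hMBP : M * (B * P) = M := by
      have h0 : (M * (B * P) - M).transpose * (M * (B * P) - M) = 0 := by
        have h1 : (M * (B * P) - M).transpose * (M * (B * P) - M) =
            (B * P) * P * (B * P) - (B * P) * P - P * (B * P) + P := by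
          rw [Matrix.transpose_sub, Matrix.transpose_mul, hBPsym, hPdef]
          noncomm_ring
        rw [h1, ← Matrix.mul_assoc P B P, hPBP, ← hPB, hPBP]
        have h2 : P * P * B = P := by rw [Matrix.mul_assoc, hPB, ← Matrix.mul_assoc, hPBP]
        rw [← Matrix.mul_assoc P P B, h2]; simp
      rw [← Matrix.conjTranspose_eq_transpose_of_trivial, Matrix.conjTranspose_mul_self_eq_zero] at h0
      exact sub_eq_zero.mp h0
    refine ⟨B * M.transpose, ?_, ?_, ?_, ?_⟩
    · rw [Matrix.mul_assoc, Matrix.mul_assoc B, ← hPdef, hMBP]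
    · rw [Matrix.mul_assoc B, ← hPdef, ← Matrix.mul_assoc, hBPB]
    · rw [Matrix.IsSymm, Matrix.mul_assoc B, ← hPdef, hBPsym]
    · simp [Matrix.IsSymm, Matrix.transpose_mul, hBsym, Matrix.mul_assoc]
  obtain ⟨S, hS, hgS⟩ : ∃ S : Matrix (Fin n) (Fin n) ℝ, IsUnit S ∧ g = S.transpose * S := by
    obtain ⟨S, hS⟩ := CStarAlgebra.nonneg_iff_eq_star_mul_self.mp hg.posSemidef.nonneg
    rw [Matrix.star_eq_conjTranspose, Matrix.conjTranspose_eq_transpose_of_trivial] at hS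
    refine ⟨S, ?_, hS⟩
    rw [Matrix.isUnit_iff_isUnit_det, isUnit_iff_ne_zero]
    intro h0
    have := hg.det_pos
    rw [hS, Matrix.det_mul, h0, mul_zero] at this
    exact lt_irrefl _ this
  have hdet : IsUnit S.det := (Matrix.isUnit_iff_isUnit_det _).mp hS
  have hdetT : IsUnit S.transpose.det := by rwa [Matrix.det_transpose]
  obtain ⟨N, h1, h2, h3, h4⟩ := key (S.transpose⁻¹ * w * S⁻¹)
  have c1 := Matrix.nonsing_inv_mul S hdet
  have c2 := Matrix.mul_nonsing_inv S hdet
  have c3 := Matrix.nonsing_inv_mul S.transpose hdetT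
  have c4 := Matrix.mul_nonsing_inv S.transpose hdetT
  have hginv : g⁻¹ = S⁻¹ * S.transpose⁻¹ := by rw [hgS, Matrix.mul_inv_rev]
  have hwM : w = S.transpose * (S.transpose⁻¹ * w * S⁻¹) * S := by
    simp only [← Matrix.mul_assoc, c4, Matrix.one_mul]
    rw [Matrix.mul_assoc, c1, Matrix.mul_one]
  set M := S.transpose⁻¹ * w * S⁻¹ with hM
  have e1 : S⁻¹ * N * S.transpose⁻¹ * w = S⁻¹ * (N * M) * S := by
    conv_lhs => rw [hwM]
    calc _ = S⁻¹ * N * (S.transpose⁻¹ * S.transpose) * M * S := by simp only [Matrix.mul_assoc]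
      _ = _ := by rw [c3, Matrix.mul_one]; simp only [Matrix.mul_assoc]
  have e2 : w * (S⁻¹ * N * S.transpose⁻¹) = S.transpose * (M * N) * S.transpose⁻¹ := by
    conv_lhs => rw [hwM]
    calc _ = S.transpose * M * (S * S⁻¹) * N * S.transpose⁻¹ := by simp only [Matrix.mul_assoc]
      _ = _ := by rw [c2, Matrix.mul_one]; simp only [Matrix.mul_assoc]
  refine ⟨S⁻¹ * N * S.transpose⁻¹, ?_, ?_, ?_, ?_⟩
  · rw [e2]
    conv_lhs => rw [hwM]
    calc _ = S.transpose * (M * N) * (S.transpose⁻¹ * S.transpose) * M * S := by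
          simp only [Matrix.mul_assoc]
      _ = S.transpose * (M * N * M) * S := by
          rw [c3, Matrix.mul_one]; simp only [Matrix.mul_assoc]
      _ = w := by rw [h1, ← hwM]
  · rw [e1]
    calc _ = S⁻¹ * (N * M) * (S * S⁻¹) * N * S.transpose⁻¹ := by simp only [Matrix.mul_assoc]
      _ = S⁻¹ * (N * M * N) * S.transpose⁻¹ := by
          rw [c2, Matrix.mul_one]; simp only [Matrix.mul_assoc]
      _ = _ := by rw [h2]
  · have : g * (S⁻¹ * N * S.transpose⁻¹ * w) = S.transpose * (N * M) * S := by
      rw [e1, hgS]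
      calc _ = S.transpose * (S * S⁻¹) * (N * M) * S := by simp only [Matrix.mul_assoc]
        _ = _ := by rw [c2, Matrix.mul_one]
    rw [this, Matrix.IsSymm, Matrix.transpose_mul, Matrix.transpose_mul, h3.eq,
      Matrix.transpose_transpose]
    simp only [Matrix.mul_assoc]
  · have : g⁻¹ * (w * (S⁻¹ * N * S.transpose⁻¹)) = S⁻¹ * (M * N) * S.transpose⁻¹ := by
      rw [e2, hginv]
      calc _ = S⁻¹ * (S.transpose⁻¹ * S.transpose) * (M * N) * S.transpose⁻¹ := by
            simp only [Matrix.mul_assoc]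
        _ = _ := by rw [c3, Matrix.mul_one]
    rw [this, Matrix.IsSymm, Matrix.transpose_mul, Matrix.transpose_mul, h4.eq,
      Matrix.transpose_nonsing_inv, Matrix.transpose_nonsing_inv, Matrix.transpose_transpose]
    simp only [Matrix.mul_assoc]

theorem IsPseudoInverse.unique {g : Matrix (Fin n) (Fin n) ℝ} (hg : g.PosDef)
    {w W W' : Matrix (Fin n) (Fin n) ℝ}
    (h : IsPseudoInverse g w W) (h' : IsPseudoInverse g w W') : W = W' := by
  have hdet : IsUnit g.det := hg.det_pos.ne'.isUnit
  have hgT : g.transpose = g := by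
    have := hg.isHermitian.eq
    rwa [Matrix.conjTranspose_eq_transpose_of_trivial] at this
  have gi := Matrix.nonsing_inv_mul g hdet
  have gi' := Matrix.mul_nonsing_inv g hdet
  have giT : g⁻¹.transpose = g⁻¹ := by rw [Matrix.transpose_nonsing_inv, hgT]
  -- two `g`-symmetric idempotents with `p * q = p` and `q * p = q` agree
  have aux : ∀ (k ki p q : Matrix (Fin n) (Fin n) ℝ), ki * k = 1 → k.transpose = k →
      k * ki = 1 → (k * p).IsSymm → (k * q).IsSymm → p * q = p → q * p = q → p = q := by
    intro k ki p q h1 hk h2 hp hq hpq hqp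
    have a1 : p.transpose * k = k * p := by
      have := hp.eq; rwa [Matrix.transpose_mul, hk] at this
    have a2 : q.transpose * k = k * q := by
      have := hq.eq; rwa [Matrix.transpose_mul, hk] at this
    have b : k * p = k * q := by
      calc k * p = p.transpose * k := a1.symm
        _ = (p * q).transpose * k := by rw [hpq]
        _ = q.transpose * (p.transpose * k) := by rw [Matrix.transpose_mul, Matrix.mul_assoc]
        _ = k * (q * p) := by rw [a1, ← Matrix.mul_assoc, a2, Matrix.mul_assoc]
        _ = k * q := by rw [hqp]
    calc p = ki * (k * p) := by rw [← Matrix.mul_assoc, h1, Matrix.one_mul]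
      _ = q := by rw [b, ← Matrix.mul_assoc, h1, Matrix.one_mul]
  have L : W * w = W' * w := aux g g⁻¹ _ _ gi hgT gi' h.symm_left h'.symm_left
    (by rw [Matrix.mul_assoc, ← Matrix.mul_assoc w, h'.inner_inverse])
    (by rw [Matrix.mul_assoc, ← Matrix.mul_assoc w, h.inner_inverse])
  have hi : (g⁻¹ * (w * W')).IsSymm := h'.symm_right
  have R : w * W = w * W' := by
    have t := aux g g⁻¹ (w * W).transpose (w * W').transpose gi hgT gi' ?_ ?_ ?_ ?_
    · exact Matrix.transpose_injective t
    · have := h.symm_right.eq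
      rw [Matrix.transpose_mul, giT] at this
      have e : (w * W).transpose = g⁻¹ * (w * W) * g := by
        rw [← this, Matrix.mul_assoc, gi, Matrix.mul_one]
      rw [Matrix.IsSymm, e]
      simp only [← Matrix.mul_assoc, gi', Matrix.one_mul]
      rw [Matrix.transpose_mul, hgT, e]
      simp only [← Matrix.mul_assoc, gi', Matrix.one_mul]
    · have := h'.symm_right.eq
      rw [Matrix.transpose_mul, giT] at this
      have e : (w * W').transpose = g⁻¹ * (w * W') * g := by
        rw [← this, Matrix.mul_assoc, gi, Matrix.mul_one]
      rw [Matrix.IsSymm, e]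
      simp only [← Matrix.mul_assoc, gi', Matrix.one_mul]
      rw [Matrix.transpose_mul, hgT, e]
      simp only [← Matrix.mul_assoc, gi', Matrix.one_mul]
    · rw [← Matrix.transpose_mul, ← Matrix.mul_assoc, h'.inner_inverse]
    · rw [← Matrix.transpose_mul, ← Matrix.mul_assoc, h.inner_inverse]
  calc W = W * w * W := h.outer_inverse.symm
    _ = W' * (w * W') := by rw [L, Matrix.mul_assoc, R]
    _ = W' := by rw [← Matrix.mul_assoc, h'.outer_inverse]

end PseudoInverse

/-! ### Geometry of a variational family `x ↦ |ψ(x)⟩` in local coordinates -/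

section Geometry

variable {𝓗 : Type*} [NormedAddCommGroup 𝓗] [InnerProductSpace ℂ 𝓗] {n : ℕ}

/-- The partial derivative `∂_μ f` at `x`. -/
def partialDeriv {F : Type*} [NormedAddCommGroup F] [NormedSpace ℝ F]
    (f : (Fin n → ℝ) → F) (μ : Fin n) (x : Fin n → ℝ) : F :=
  fderiv ℝ f x (Pi.single μ 1)

/-- The Hessian matrix `∂_μ ∂_ν f` at `x`. -/
def hessian (f : (Fin n → ℝ) → ℝ) (x : Fin n → ℝ) : Matrix (Fin n) (Fin n) ℝ :=
  Matrix.of fun μ ν => partialDeriv (partialDeriv f ν) μ x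

/-- The tangent vector `|V_μ⟩ = Q_ψ ∂_μ |ψ⟩` at `x`, where
`Q_ψ |X⟩ = |X⟩ - (⟨ψ|X⟩ / ⟨ψ|ψ⟩) |ψ⟩`. -/
def tangentVector (ψ : (Fin n → ℝ) → 𝓗) (x : Fin n → ℝ) (μ : Fin n) : 𝓗 :=
  partialDeriv ψ μ x - (inner ℂ (ψ x) (partialDeriv ψ μ x) / inner ℂ (ψ x) (ψ x)) • ψ x

/-- The restricted metric `g_{μν} = 2 Re⟨V_μ|V_ν⟩ / ⟨ψ|ψ⟩`. -/
def metric (ψ : (Fin n → ℝ) → 𝓗) (x : Fin n → ℝ) : Matrix (Fin n) (Fin n) ℝ :=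
  Matrix.of fun μ ν =>
    2 * (inner ℂ (tangentVector ψ x μ) (tangentVector ψ x ν)).re / ‖ψ x‖ ^ 2

/-- The restricted symplectic form `ω_{μν} = 2 Im⟨V_μ|V_ν⟩ / ⟨ψ|ψ⟩`. -/
def symplecticForm (ψ : (Fin n → ℝ) → 𝓗) (x : Fin n → ℝ) : Matrix (Fin n) (Fin n) ℝ :=
  Matrix.of fun μ ν =>
    2 * (inner ℂ (tangentVector ψ x μ) (tangentVector ψ x ν)).im / ‖ψ x‖ ^ 2

/-- `Ω^{μν}`: the pseudo-inverse of `ω` with respect to `g`, which is the inverse of `ω` if `ω` is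
invertible. -/
def symplecticInverse (ψ : (Fin n → ℝ) → 𝓗) (x : Fin n → ℝ) : Matrix (Fin n) (Fin n) ℝ :=
  pseudoInverse (metric ψ x) (symplecticForm ψ x)

open Classical in
/-- The expectation value `⟨φ|A|φ⟩ / ⟨φ|φ⟩` of a symmetric, possibly unbounded, operator; the
value `0` for `φ` outside the domain is not used. -/
def expectation (A : 𝓗 →ₗ.[ℂ] 𝓗) (φ : 𝓗) : ℝ :=
  if h : φ ∈ A.domain then (inner ℂ φ (A ⟨φ, h⟩)).re / ‖φ‖ ^ 2 else 0

/-- The function `A(x) = ⟨ψ(x)|A|ψ(x)⟩ / ⟨ψ(x)|ψ(x)⟩` on the variational family. -/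
def observable (ψ : (Fin n → ℝ) → 𝓗) (A : 𝓗 →ₗ.[ℂ] 𝓗) (x : Fin n → ℝ) : ℝ :=
  expectation A (ψ x)

/-- The gradient covector `∂_μ A`. -/
def gradient (ψ : (Fin n → ℝ) → 𝓗) (A : 𝓗 →ₗ.[ℂ] 𝓗) (x : Fin n → ℝ) : Fin n → ℝ :=
  fun μ => partialDeriv (observable ψ A) μ x

/-- The vector field `𝒳^μ = - Ω^{μν} ∂_ν ⟨A⟩` of the real time evolution generated by the
Hamiltonian `A`, projected according to the Lagrangian action principle. -/
def lagrangianField (ψ : (Fin n → ℝ) → 𝓗) (A : 𝓗 →ₗ.[ℂ] 𝓗) (x : Fin n → ℝ) : Fin n → ℝ :=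
  -(symplecticInverse ψ x).mulVec (gradient ψ A x)

/-- The generator `K = - Ω ∂∂E` of the linearized evolution. -/
def generator (ψ : (Fin n → ℝ) → 𝓗) (H : 𝓗 →ₗ.[ℂ] 𝓗) (x : Fin n → ℝ) :
    Matrix (Fin n) (Fin n) ℝ :=
  -(symplecticInverse ψ x * hessian (observable ψ H) x)

/-- A complete system of symplectically normalized eigenvectors of `K` for its non-zero
eigenvalues `i ω_ℓ`, counted with multiplicity:
`K ℰ_ℓ = i ω_ℓ ℰ_ℓ` and `ℰ_ℓ^* ω ℰ_m = i sgn(ω_ℓ) δ_{ℓm}`. -/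
structure IsNormalizedEigensystem (w K : Matrix (Fin n) (Fin n) ℝ) {ι : Type} [DecidableEq ι]
    (freq : ι → ℝ) (e : ι → Fin n → ℂ) : Prop where
  freq_ne_zero : ∀ l, freq l ≠ 0
  eigen : ∀ l, (K.map ((↑) : ℝ → ℂ)).mulVec (e l) = (Complex.I * (freq l : ℂ)) • e l
  normalized : ∀ l m, star (e l) ⬝ᵥ (w.map ((↑) : ℝ → ℂ)).mulVec (e m) =
    if l = m then Complex.I * (Real.sign (freq l) : ℂ) else 0
  complete : ∀ (c : ℂ) (v : Fin n → ℂ), c ≠ 0 →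
    (K.map ((↑) : ℝ → ℂ)).mulVec v = c • v → v ∈ Submodule.span ℂ (Set.range e)

end Geometry

/-! ### Linear response on the variational family -/

section Response

variable {𝓗 : Type*} [NormedAddCommGroup 𝓗] [InnerProductSpace ℂ 𝓗] {n : ℕ}

/-- `x` is, for times `t < T`, a trajectory in the coordinate domain `U` of the projected real time
evolution under the perturbed Hamiltonian `H + ε φ(t) V`, starting at `x₀` in the distant past. -/
def IsPerturbedEvolution (U : Set (Fin n → ℝ)) (ψ : (Fin n → ℝ) → 𝓗) (H V : 𝓗 →ₗ.[ℂ] 𝓗)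
    (x₀ : Fin n → ℝ) (φ : ℝ → ℝ) (ε T : ℝ) (x : ℝ → Fin n → ℝ) : Prop :=
  (∀ᶠ t in atBot, x t = x₀) ∧
    ∀ t < T, x t ∈ U ∧
      HasDerivAt x (lagrangianField ψ (H + ((ε * φ t : ℝ) : ℂ) • V) (x t)) t

/-- `δV` is the linear response of `⟨V⟩` to the probe `φ`: up to any time `T` the perturbed
evolution exists for all small `ε`, and along it `δV(t) = d/dε|_{ε=0} ⟨ψ_ε(t)|V|ψ_ε(t)⟩/⟨ψ_ε(t)|ψ_ε(t)⟩`. -/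
def IsLinearResponse (U : Set (Fin n → ℝ)) (ψ : (Fin n → ℝ) → 𝓗) (H V : 𝓗 →ₗ.[ℂ] 𝓗)
    (x₀ : Fin n → ℝ) (φ δV : ℝ → ℝ) : Prop :=
  ∀ T : ℝ,
    (∀ᶠ ε in 𝓝 (0 : ℝ), ∃ x, IsPerturbedEvolution U ψ H V x₀ φ ε T x) ∧
    ∀ x : ℝ → ℝ → Fin n → ℝ,
      (∀ᶠ ε in 𝓝 (0 : ℝ), IsPerturbedEvolution U ψ H V x₀ φ ε T (x ε)) →
      ∀ t < T, HasDerivAt (fun ε => observable ψ V (x ε t)) (δV t) 0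

/-- `s ↦ ∫ exp(i u s) f(u) du`. -/
def physFourier (f : ℝ → ℂ) (s : ℝ) : ℂ :=
  ∫ u : ℝ, Complex.exp (Complex.I * u * s) * f u

/-- The tempered distribution `G` (in the frequency `ω`) is the retarded Green's function of linear
response theory on the variational family: every probe `φ` (continuous with compact support) has a
linear response `δV`, and `∫ exp(i ω t) δV(t) dt = φ̃(ω) G(ω)` as tempered distributions, where
`φ̃(ω) = ∫ exp(i ω t) φ(t) dt`. Tested against `θ(ω)`, the left side is
`∫ δV(t) (∫ exp(i ω t) θ(ω) dω) dt` and the right side is `G` applied to `η = φ̃ θ`. -/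
def IsRetardedGreenFunction (U : Set (Fin n → ℝ)) (ψ : (Fin n → ℝ) → 𝓗) (H V : 𝓗 →ₗ.[ℂ] 𝓗)
    (x₀ : Fin n → ℝ) (G : 𝓢'(ℝ, ℂ)) : Prop :=
  ∀ φ : ℝ → ℝ, Continuous φ → HasCompactSupport φ →
    ∃ δV : ℝ → ℝ, IsLinearResponse U ψ H V x₀ φ δV ∧
      ∀ θ η : 𝓢(ℝ, ℂ), (∀ w, η w = physFourier (fun t => (φ t : ℂ)) w * θ w) →
        Integrable (fun t => (δV t : ℂ) * physFourier θ t) ∧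
        ∫ t, (δV t : ℂ) * physFourier θ t = G η

/-- `A` is the spectral function `A(ω) = -(1/π) Im G(ω)` of linear response theory on the
variational family; a tempered distribution is determined by its values on real test functions. -/
def IsSpectralFunction (U : Set (Fin n → ℝ)) (ψ : (Fin n → ℝ) → 𝓗) (H V : 𝓗 →ₗ.[ℂ] 𝓗)
    (x₀ : Fin n → ℝ) (A : 𝓢'(ℝ, ℂ)) : Prop :=
  ∃ G : 𝓢'(ℝ, ℂ), IsRetardedGreenFunction U ψ H V x₀ G ∧
    ∀ θ : 𝓢(ℝ, ℂ), (∀ w, (θ w).im = 0) → A θ = ((-(1 / Real.pi) * (G θ).im : ℝ) : ℂ)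

end Response

/-- `sgn A(ω) = sgn ω` for a tempered distribution `A`, on its support: `0` is not in the support
of `A`, and `A` is strictly positive on `ω > 0` and strictly negative on `ω < 0` wherever it does
not vanish. -/
def SignEqSignFrequency (A : 𝓢'(ℝ, ℂ)) : Prop :=
  (0 : ℝ) ∉ Distribution.dsupport (fun θ : 𝓢(ℝ, ℂ) => A θ) ∧
    ∀ θ : 𝓢(ℝ, ℂ), (∀ w, (θ w).im = 0 ∧ 0 ≤ (θ w).re) →
      ((∀ w ≤ 0, θ w = 0) → ∃ r : ℝ, A θ = r ∧ 0 ≤ r ∧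
        ((∃ w ∈ Distribution.dsupport (fun θ : 𝓢(ℝ, ℂ) => A θ), θ w ≠ 0) → 0 < r)) ∧
      ((∀ w ≥ 0, θ w = 0) → ∃ r : ℝ, A θ = r ∧ r ≤ 0 ∧
        ((∃ w ∈ Distribution.dsupport (fun θ : 𝓢(ℝ, ℂ) => A θ), θ w ≠ 0) → r < 0))

end

end VariationalResponse

namespace VariationalResponse

open Filter Topology MeasureTheory

/-! At `x₀` the gradient of `E` vanishes, so differentiating `Ω` contributes nothing and the
trajectories linearize to `u' = K u + φ b` with `b = -Ω ∂V`. Write the positive definite Hessian as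
`A = SᵀS`. Then `S K S⁻¹ = -S Ω Sᵀ` is real antisymmetric, so `K` is diagonalizable with imaginary
eigenvalues and `A`-orthonormal eigenvectors (`LinearizedData.exists_eigenbasis`). Eigenvectors with
non-zero eigenvalue lie in the range of `Ω`, where `Ω ω` is the identity. Hence `v^* ω v' = (i / d)
v^* A v'` if `v'` has eigenvalue `i d` (`LinearizedData.form_eq_hessian`). This is the source of the
sign of the frequency, and it makes the symplectic normalization possible even for degenerate `ω`.

The force `b` lies in the range of `K`, so it expands in any complete normalized eigensystem, with
coefficients `i sgn(ω_ℓ) (ℰ_ℓ ∂V)^*` (`LinearizedData.force_eq_sum`). Duhamel's formula then gives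
`δV` as the convolution of `φ` with `1_{t ≥ 0} χ(t)`, where `χ(t) = ∑ i sgn(ω_ℓ) |ℰ_ℓ ∂V|² exp(i ω_ℓ
t)`, and `G^R` is the Fourier transform of this causal function. Since `χ` is real and odd, `G^R`
minus its conjugate is the transform of `χ` over the whole line, which is a sum of delta functions
(`im_greenFunction`). The signs of the weights give the last claim.

Three analytic points remain. Constant rank makes `Ω`, hence the vector field, `C¹`
(`MatrixContDiffAt.pseudoInverse`). Exponential barriers keep trajectories `O(ε)`-close to `x₀` and
their error against `ε u` at `o(ε)` (`LinearBound.norm_sub_le`, `hasDerivAt_forcedTrajectory`), and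
they give existence up to any time after truncating the fields. Uniqueness of `G^R` needs a single
probe whose Fourier transform never vanishes and has an inverse of tempered growth (`hatProbe`). -/

/-! ### Smooth dependence of the pseudo-inverse -/

section SmoothMatrix

variable {E : Type*} [NormedAddCommGroup E] [NormedSpace ℝ E] {k : WithTop ℕ∞} {x : E}
  {l m p : Type*}

/-- All entries of the matrix-valued function `M` are `C^k` at `x`. -/
def MatrixContDiffAt (k : WithTop ℕ∞) (M : E → Matrix l m ℝ) (x : E) : Prop :=
  ∀ i j, ContDiffAt ℝ k (fun y => M y i j) x

theorem MatrixContDiffAt.const (M : Matrix l m ℝ) : MatrixContDiffAt k (fun _ : E => M) x :=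
  fun _ _ => contDiffAt_const

theorem MatrixContDiffAt.mul [Fintype m] {M : E → Matrix l m ℝ} {N : E → Matrix m p ℝ}
    (hM : MatrixContDiffAt k M x) (hN : MatrixContDiffAt k N x) :
    MatrixContDiffAt k (fun y => M y * N y) x := fun i j => by
  simp only [Matrix.mul_apply]
  exact ContDiffAt.sum fun a _ => (hM i a).mul (hN a j)

theorem MatrixContDiffAt.transpose {M : E → Matrix l m ℝ} (hM : MatrixContDiffAt k M x) :
    MatrixContDiffAt k (fun y => (M y).transpose) x := fun i j => hM j i

theorem MatrixContDiffAt.det [Fintype m] [DecidableEq m] {M : E → Matrix m m ℝ}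
    (hM : MatrixContDiffAt k M x) :
    ContDiffAt ℝ k (fun y => (M y).det) x := by
  simp only [Matrix.det_apply]
  exact ContDiffAt.sum fun σ _ => (contDiffAt_prod fun i _ => hM (σ i) i).const_smul _

theorem MatrixContDiffAt.inv [Fintype m] [DecidableEq m] {M : E → Matrix m m ℝ}
    (hM : MatrixContDiffAt k M x)
    (h : (M x).det ≠ 0) : MatrixContDiffAt k (fun y => (M y)⁻¹) x := fun i j => by
  simp only [Matrix.inv_def, Ring.inverse_eq_inv', Matrix.smul_apply, Matrix.adjugate_apply,
    smul_eq_mul]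
  refine (hM.det.inv h).mul (MatrixContDiffAt.det fun a b => ?_)
  simp only [Matrix.updateRow_apply]
  split_ifs
  · exact contDiffAt_const
  · exact hM a b

end SmoothMatrix

/-! ### Antisymmetry and full rank factorization of the pseudo-inverse. -/

section PseudoInverse

variable {n : ℕ}

theorem isPseudoInverse_pseudoInverse {g : Matrix (Fin n) (Fin n) ℝ} (hg : g.PosDef)
    (w : Matrix (Fin n) (Fin n) ℝ) : IsPseudoInverse g w (pseudoInverse g w) :=
  Classical.epsilon_spec (exists_isPseudoInverse hg w)

/-- Transposition exchanges `W * w` with `w * W`, and with them the two symmetry conditions; the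
metric translates one condition into the other. Together with uniqueness this makes the
pseudo-inverse antisymmetric. -/
theorem IsPseudoInverse.neg_transpose {g w W : Matrix (Fin n) (Fin n) ℝ} (hg : g.PosDef)
    (hw : w.transpose = -w) (h : IsPseudoInverse g w W) :
    IsPseudoInverse g w (-W.transpose) := by
  have hdet : IsUnit g.det := hg.det_pos.ne'.isUnit
  have hgT : g.transpose = g := by
    have := hg.isHermitian.eq
    rwa [Matrix.conjTranspose_eq_transpose_of_trivial] at this
  have giT : g⁻¹.transpose = g⁻¹ := by rw [Matrix.transpose_nonsing_inv, hgT]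
  have gi := Matrix.nonsing_inv_mul g hdet
  have gi' := Matrix.mul_nonsing_inv g hdet
  have hw' : w = -w.transpose := by rw [hw, neg_neg]
  have e1 : -W.transpose * w = (w * W).transpose := by
    rw [Matrix.transpose_mul, hw]; simp
  have e2 : w * -W.transpose = (W * w).transpose := by
    rw [Matrix.transpose_mul, hw]; simp
  refine ⟨?_, ?_, ?_, ?_⟩
  · rw [e2]
    nth_rw 2 [hw']
    rw [Matrix.mul_neg, ← Matrix.transpose_mul, ← Matrix.mul_assoc, h.inner_inverse, hw, neg_neg]
  · rw [e1, Matrix.mul_neg, ← Matrix.transpose_mul, ← Matrix.mul_assoc, h.outer_inverse]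
  · rw [e1]
    have := h.symm_right.eq
    rw [Matrix.transpose_mul, giT] at this
    have e : (w * W).transpose = g⁻¹ * (w * W) * g := by
      rw [← this, Matrix.mul_assoc, gi, Matrix.mul_one]
    rw [Matrix.IsSymm, Matrix.transpose_mul, Matrix.transpose_transpose, hgT, e]
    simp only [← Matrix.mul_assoc, gi', Matrix.one_mul]
  · rw [e2]
    have := h.symm_left.eq
    rw [Matrix.transpose_mul, hgT] at this
    have e : (W * w).transpose = g * (W * w) * g⁻¹ := by
      rw [← this, Matrix.mul_assoc, gi', Matrix.mul_one]
    rw [Matrix.IsSymm, Matrix.transpose_mul, Matrix.transpose_transpose, giT, e]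
    simp only [← Matrix.mul_assoc, gi, Matrix.one_mul]

/-- The pseudo-inverse of an antisymmetric form is antisymmetric. -/
theorem transpose_pseudoInverse {g w : Matrix (Fin n) (Fin n) ℝ} (hg : g.PosDef)
    (hw : w.transpose = -w) : (pseudoInverse g w).transpose = -pseudoInverse g w := by
  have h := isPseudoInverse_pseudoInverse hg w
  exact neg_eq_iff_eq_neg.mp ((h.neg_transpose hg hw).unique hg h)

variable {r : ℕ}

/-- The pseudo-inverse computed from a full rank factorization `w = C * R`. -/
theorem IsPseudoInverse.of_factorization {g w : Matrix (Fin n) (Fin n) ℝ} (hg : g.PosDef)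
    {C : Matrix (Fin n) (Fin r) ℝ} {R : Matrix (Fin r) (Fin n) ℝ} (hw : w = C * R)
    (h1 : (R * g⁻¹ * R.transpose).det ≠ 0) (h2 : (C.transpose * g⁻¹ * C).det ≠ 0) :
    IsPseudoInverse g w (g⁻¹ * R.transpose * (R * g⁻¹ * R.transpose)⁻¹ *
      ((C.transpose * g⁻¹ * C)⁻¹ * C.transpose * g⁻¹)) := by
  have hdet : IsUnit g.det := hg.det_pos.ne'.isUnit
  have hgT : g.transpose = g := by
    have := hg.isHermitian.eq
    rwa [Matrix.conjTranspose_eq_transpose_of_trivial] at this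
  have giT : g⁻¹.transpose = g⁻¹ := by rw [Matrix.transpose_nonsing_inv, hgT]
  have gi' := Matrix.mul_nonsing_inv g hdet
  have r1 := Matrix.mul_nonsing_inv _ h1.isUnit
  have c1 := Matrix.nonsing_inv_mul _ h2.isUnit
  set P := R * g⁻¹ * R.transpose with hP
  set S := C.transpose * g⁻¹ * C with hS
  have hPT : P⁻¹.transpose = P⁻¹ := by
    rw [Matrix.transpose_nonsing_inv, hP]
    simp only [Matrix.transpose_mul, Matrix.transpose_transpose, giT, Matrix.mul_assoc]
  have hST : S⁻¹.transpose = S⁻¹ := by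
    rw [Matrix.transpose_nonsing_inv, hS]
    simp only [Matrix.transpose_mul, Matrix.transpose_transpose, giT, Matrix.mul_assoc]
  -- `w * W` is the `g⁻¹`-orthogonal projection onto the columns of `C`, and `W * w` below is the
  -- `g`-orthogonal projection onto the range of `g⁻¹ * Rᵀ`. All four conditions follow from these
  -- two forms.
  have e1 : w * (g⁻¹ * R.transpose * P⁻¹ * (S⁻¹ * C.transpose * g⁻¹)) =
      C * S⁻¹ * C.transpose * g⁻¹ := by
    calc _ = C * (P * P⁻¹) * S⁻¹ * C.transpose * g⁻¹ := by
          rw [hw, hP]; simp only [Matrix.mul_assoc]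
      _ = _ := by rw [r1, Matrix.mul_one]
  have e2 : g⁻¹ * R.transpose * P⁻¹ * (S⁻¹ * C.transpose * g⁻¹) * w =
      g⁻¹ * R.transpose * P⁻¹ * R := by
    calc _ = g⁻¹ * R.transpose * P⁻¹ * (S⁻¹ * S) * R := by
          rw [hw, hS]; simp only [Matrix.mul_assoc]
      _ = _ := by rw [c1, Matrix.mul_one]
  refine ⟨?_, ?_, ?_, ?_⟩
  · rw [e1, hw]
    calc _ = C * (S⁻¹ * S) * R := by rw [hS]; simp only [Matrix.mul_assoc]
      _ = _ := by rw [c1, Matrix.mul_one]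
  · rw [e2]
    calc _ = g⁻¹ * R.transpose * P⁻¹ * (P * P⁻¹) * S⁻¹ * C.transpose * g⁻¹ := by
          rw [hP]; simp only [Matrix.mul_assoc]
      _ = _ := by rw [r1, Matrix.mul_one]; simp only [Matrix.mul_assoc]
  · rw [e2]
    have : g * (g⁻¹ * R.transpose * P⁻¹ * R) = R.transpose * P⁻¹ * R := by
      simp only [← Matrix.mul_assoc, gi', Matrix.one_mul]
    rw [this, Matrix.IsSymm]
    simp only [Matrix.transpose_mul, Matrix.transpose_transpose, hPT, Matrix.mul_assoc]
  · rw [e1, Matrix.IsSymm]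
    simp only [Matrix.transpose_mul, Matrix.transpose_transpose, hST, giT, Matrix.mul_assoc]

/-- A choice of columns whose images under `w` form a basis of the range of `w`. -/
theorem exists_columns (w : Matrix (Fin n) (Fin n) ℝ) :
    ∃ Q : Matrix (Fin n) (Fin w.rank) ℝ, Function.Injective (w * Q).mulVec := by
  obtain ⟨b⟩ : Nonempty (Module.Basis (Fin w.rank) ℝ (LinearMap.range w.mulVecLin)) :=
    ⟨Module.finBasis ℝ (LinearMap.range w.mulVecLin)⟩
  have hb : ∀ i, ∃ v, w.mulVec v = (b i : Fin n → ℝ) := fun i => (b i).2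
  choose v hv using hb
  refine ⟨Matrix.of fun a i => v i a, ?_⟩
  rw [Matrix.mulVec_injective_iff]
  have : (w * Matrix.of fun a i => v i a).col = fun i => (b i : Fin n → ℝ) := by
    funext i a
    rw [← hv i]
    simp [Matrix.col_apply, Matrix.mul_apply, Matrix.mulVec, dotProduct]
  rw [this]
  exact b.linearIndependent.map' _ (Submodule.ker_subtype _)

/-- The `r` independent columns of `C = w * Q` fill the range of `w` by dimension count, and
`(CᵀC)⁻¹ Cᵀ` is a left inverse of `C` that reads off coordinates. The same `Q` can thus serve all
nearby forms of equal rank. -/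
theorem factorization_of_rank {w : Matrix (Fin n) (Fin n) ℝ} {Q : Matrix (Fin n) (Fin r) ℝ}
    (hr : w.rank = r) (h : ((w * Q).transpose * (w * Q)).det ≠ 0) :
    w = (w * Q) * (((w * Q).transpose * (w * Q))⁻¹ * (w * Q).transpose * w) := by
  set C := w * Q with hC
  have c1 := Matrix.nonsing_inv_mul _ h.isUnit
  have hinj : Function.Injective C.mulVec := by
    intro a b hab
    have := congrArg (((C.transpose * C)⁻¹ * C.transpose).mulVec) hab
    simp only [Matrix.mulVec_mulVec, Matrix.mul_assoc] at this
    rwa [c1, Matrix.one_mulVec, Matrix.one_mulVec] at this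
  have hle : LinearMap.range C.mulVecLin ≤ LinearMap.range w.mulVecLin := by
    rintro _ ⟨v, rfl⟩
    exact ⟨Q.mulVec v, by simp [hC, Matrix.mulVec_mulVec]⟩
  have heq : LinearMap.range C.mulVecLin = LinearMap.range w.mulVecLin := by
    refine Submodule.eq_of_le_of_finrank_eq hle ?_
    rw [LinearMap.finrank_range_of_inj hinj]
    simpa [Matrix.rank] using hr.symm
  apply Matrix.mulVec_injective
  funext v
  obtain ⟨u, hu⟩ : w.mulVec v ∈ LinearMap.range C.mulVecLin := heq ▸ ⟨v, rfl⟩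
  have hu' : C.mulVec u = w.mulVec v := hu
  calc w.mulVec v = C.mulVec (((C.transpose * C)⁻¹ * (C.transpose * C)).mulVec u) := by
        rw [c1, Matrix.one_mulVec, hu']
    _ = _ := by
        simp only [← Matrix.mulVec_mulVec, hu', Matrix.mul_assoc]

variable {E : Type*} [NormedAddCommGroup E] [NormedSpace ℝ E]

/-- The pseudo-inverse is as smooth as the metric and the form where the rank is constant. -/
theorem MatrixContDiffAt.pseudoInverse {k : WithTop ℕ∞} {x : E}
    {g w : E → Matrix (Fin n) (Fin n) ℝ}
    (hgk : MatrixContDiffAt k g x) (hwk : MatrixContDiffAt k w x)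
    (hg : ∀ᶠ y in 𝓝 x, (g y).PosDef) (hr : ∀ᶠ y in 𝓝 x, (w y).rank = (w x).rank) :
    MatrixContDiffAt k (fun y => pseudoInverse (g y) (w y)) x := by
  -- `Q` is frozen at `x`. Independence of the columns of `w y * Q` is an open condition, and
  -- constant rank makes them span the range. The factorization formula is then rational in the
  -- entries of `g` and `w`.
  obtain ⟨Q, hQ⟩ := exists_columns (w x)
  have injT : ∀ {r : ℕ} {M : Matrix (Fin n) (Fin r) ℝ} {G : Matrix (Fin n) (Fin n) ℝ}, G.PosDef →
      Function.Injective M.mulVec → (M.transpose * G * M).det ≠ 0 := by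
    intro r M G hG hM
    have := (hG.conjTranspose_mul_mul_same hM).det_pos.ne'
    rwa [Matrix.conjTranspose_eq_transpose_of_trivial] at this
  set C : E → Matrix (Fin n) (Fin (w x).rank) ℝ := fun y => w y * Q with hC
  have hCk : MatrixContDiffAt k C x := hwk.mul (.const Q)
  have hC0 : ((C x).transpose * C x).det ≠ 0 := by
    simpa only [Matrix.mul_one] using injT Matrix.PosDef.one hQ
  set D : E → Matrix (Fin (w x).rank) (Fin (w x).rank) ℝ := fun y => (C y).transpose * C y with hD
  have hDk : MatrixContDiffAt k D x := hCk.transpose.mul hCk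
  set R : E → Matrix (Fin (w x).rank) (Fin n) ℝ := fun y => (D y)⁻¹ * (C y).transpose * w y with hR
  have hRk : MatrixContDiffAt k R x := ((hDk.inv hC0).mul hCk.transpose).mul hwk
  have key : ∀ {y}, (g y).PosDef → (w y).rank = (w x).rank → (D y).det ≠ 0 →
      w y = C y * R y ∧ (R y * (g y)⁻¹ * (R y).transpose).det ≠ 0 ∧
        ((C y).transpose * (g y)⁻¹ * C y).det ≠ 0 := by
    intro y hgy hry hDy
    have c1 := Matrix.nonsing_inv_mul _ hDy.isUnit
    refine ⟨factorization_of_rank hry hDy, ?_, ?_⟩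
    · have hRQ : R y * Q = 1 := by
        rw [hR]; simp only [Matrix.mul_assoc]; exact c1
      have := @injT _ (R y).transpose _ hgy.inv (by
        intro a b hab
        have := congrArg (Q.transpose.mulVec) hab
        simpa only [Matrix.mulVec_mulVec, ← Matrix.transpose_mul, hRQ, Matrix.transpose_one,
          Matrix.one_mulVec] using this)
      simpa using this
    · refine injT hgy.inv ?_
      intro a b hab
      have := congrArg (((D y)⁻¹ * (C y).transpose).mulVec) hab
      simp only [Matrix.mulVec_mulVec, Matrix.mul_assoc] at this
      rwa [c1, Matrix.one_mulVec, Matrix.one_mulVec] at this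
  have hD0 : ∀ᶠ y in 𝓝 x, (D y).det ≠ 0 :=
    (hDk.det.continuousAt).eventually_ne hC0
  obtain ⟨-, k1, k2⟩ := key hg.self_of_nhds rfl hC0
  have hgi : MatrixContDiffAt k (fun y => (g y)⁻¹) x := hgk.inv hg.self_of_nhds.det_pos.ne'
  have F := ((hgi.mul hRk.transpose).mul (((hRk.mul hgi).mul hRk.transpose).inv k1)).mul
    (((((hCk.transpose.mul hgi).mul hCk).inv k2).mul hCk.transpose).mul hgi)
  intro i j
  refine (F i j).congr_of_eventuallyEq ?_
  filter_upwards [hg, hr, hD0] with y hgy hry hDy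
  obtain ⟨kw, k1, k2⟩ := key hgy hry hDy
  rw [(isPseudoInverse_pseudoInverse hgy (w y)).unique hgy
    (IsPseudoInverse.of_factorization hgy kw k1 k2)]

end PseudoInverse

/-! ### Weakly forced differential equations near an equilibrium -/

section Forced

variable {E : Type*} [NormedAddCommGroup E] [NormedSpace ℝ E]

/-- A fencing form of Gronwall: the speed is compared only at times when the norm touches the
barrier, so estimates valid only near the equilibrium suffice. The reference time `a` is independent
of `t₀`, which keeps the bound uniform in the starting time. -/
theorem norm_le_exp_of_norm_deriv_lt {z z' : ℝ → E} {a t₀ t₁ β c : ℝ}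
    (hβ : 0 ≤ β) (h0 : z t₀ = 0) (hz : ContinuousOn z (Set.Icc t₀ t₁))
    (hz' : ∀ t ∈ Set.Ico t₀ t₁, HasDerivWithinAt z (z' t) (Set.Ici t) t)
    (bound : ∀ t ∈ Set.Ico t₀ t₁, ‖z t‖ = β * Real.exp (c * (t - a)) →
      ‖z' t‖ < c * (β * Real.exp (c * (t - a)))) {t : ℝ} (ht : t ∈ Set.Icc t₀ t₁) :
    ‖z t‖ ≤ β * Real.exp (c * (t - a)) := by
  refine image_norm_le_of_norm_deriv_right_lt_deriv_boundary hz hz'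
    (by rw [h0, norm_zero]; positivity)
    (fun s => ?_) bound ht
  have h1 : HasDerivAt (fun s : ℝ => c * (s - a)) (c * 1) s :=
    ((hasDerivAt_id s).sub_const a).const_mul c
  exact (h1.exp.const_mul β).congr_deriv (by ring)

/-- Bounds on the fields `X` (vanishing at `x₀`) and `Y` on a ball. -/
structure LinearBound (X Y : E → E) (x₀ : E) (C r : ℝ) : Prop where
  pos : 0 < C
  radius_pos : 0 < r
  field : ∀ x ∈ Metric.closedBall x₀ r, ‖X x‖ ≤ C * ‖x - x₀‖
  force : ∀ x ∈ Metric.closedBall x₀ r, ‖Y x‖ ≤ C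

/-- Solutions of `x' = X(x) + ε φ(t) Y(x)` which start at the equilibrium are `O(ε)`. -/
theorem LinearBound.norm_sub_le {X Y : E → E} {x₀ : E} {C r : ℝ} (h : LinearBound X Y x₀ C r)
    {φ : ℝ → ℝ} {Φ a : ℝ} (hΦ : ∀ t, |φ t| ≤ Φ) (ha : ∀ t ≤ a, φ t = 0)
    {ε δ t₀ t₁ : ℝ} (hδ : 0 < δ) (hε : |ε| ≤ δ)
    (hr : (C * Φ + 1) * δ * Real.exp ((C + 1) * (t₁ - a)) ≤ r)
    {x : ℝ → E} (h0 : x t₀ = x₀) (hx : ContinuousOn x (Set.Icc t₀ t₁))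
    (hx' : ∀ t ∈ Set.Ico t₀ t₁,
      HasDerivWithinAt x (X (x t) + (ε * φ t) • Y (x t)) (Set.Ici t) t)
    {t : ℝ} (ht : t ∈ Set.Icc t₀ t₁) :
    ‖x t - x₀‖ ≤ (C * Φ + 1) * δ * Real.exp ((C + 1) * (t - a)) := by
  have hC := h.pos
  have hΦ0 : 0 ≤ Φ := (abs_nonneg _).trans (hΦ 0)
  have hM : 0 < C * Φ + 1 := by positivity
  refine norm_le_exp_of_norm_deriv_lt (z := fun t => x t - x₀)
    (z' := fun t => X (x t) + (ε * φ t) • Y (x t)) (by positivity) (by simp [h0])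
    (hx.sub continuousOn_const) (fun t ht => (hx' t ht).sub_const x₀) (fun s hs hb => ?_) ht
  set e := Real.exp ((C + 1) * (s - a)) with he
  have he0 : 0 < e := Real.exp_pos _
  -- On the barrier the point is still in the ball, since the barrier has height at most `r` at
  -- `t₁`. There the speed is at most `(C * (C * Φ + 1) + C * Φ) * δ * e`, less than the barrier's
  -- slope.
  have hmem : x s ∈ Metric.closedBall x₀ r := by
    rw [mem_closedBall_iff_norm, hb]
    refine le_trans ?_ hr
    rw [he]
    gcongr
    exact hs.2.le
  have h1 : ‖X (x s)‖ ≤ C * ((C * Φ + 1) * δ * e) := hb ▸ h.field _ hmem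
  have h2 : ‖(ε * φ s) • Y (x s)‖ ≤ C * Φ * δ * e := by
    rcases le_or_gt s a with hsa | hsa
    -- Before `a` the exponential may be arbitrarily small, but there the force is absent.
    · rw [ha s hsa, mul_zero, zero_smul, norm_zero]; positivity
    · have he1 : 1 ≤ e := Real.one_le_exp (mul_nonneg (by positivity) (by linarith))
      rw [norm_smul, Real.norm_eq_abs, abs_mul]
      calc |ε| * |φ s| * ‖Y (x s)‖ ≤ δ * Φ * C := by
            gcongr
            · exact hΦ s
            · exact h.force _ hmem
        _ = C * Φ * δ * 1 := by ring
        _ ≤ C * Φ * δ * e := by gcongr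
  calc ‖X (x s) + (ε * φ s) • Y (x s)‖ ≤ C * ((C * Φ + 1) * δ * e) + C * Φ * δ * e :=
        (norm_add_le _ _).trans (add_le_add h1 h2)
    _ < (C + 1) * ((C * Φ + 1) * δ * e) := by nlinarith [mul_pos hδ he0]

/-- Differentiability at the single point `x₀` already bounds `X` linearly near it. Taking `C` at
least `‖K‖` lets the same exponent control the linearized flow. -/
theorem exists_linearBound {X Y : E → E} {x₀ : E} {K : E →L[ℝ] E} (hX0 : X x₀ = 0)
    (hX : HasFDerivAt X K x₀) (hY : ContinuousAt Y x₀) {s : Set E} (hs : s ∈ 𝓝 x₀) :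
    ∃ C r, LinearBound X Y x₀ C r ∧ Metric.closedBall x₀ r ⊆ s ∧ ‖K‖ ≤ C := by
  have h1 : ∀ᶠ x in 𝓝 x₀, ‖X x - X x₀ - K (x - x₀)‖ ≤ 1 * ‖x - x₀‖ :=
    (Asymptotics.isLittleO_iff.mp hX.isLittleO) one_pos
  have h2 : ∀ᶠ x in 𝓝 x₀, ‖Y x‖ < ‖Y x₀‖ + 1 :=
    hY.norm.eventually_lt continuousAt_const (by simp)
  obtain ⟨r, hr, hr'⟩ := Metric.nhds_basis_closedBall.mem_iff.mp (inter_mem (inter_mem h1 h2) hs)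
  set C := ‖K‖ + ‖Y x₀‖ + 1 with hC
  have p1 := norm_nonneg K
  have p2 := norm_nonneg (Y x₀)
  refine ⟨C, r, ⟨by positivity, hr, fun x hx => ?_, fun x hx => ?_⟩, fun x hx => (hr' hx).2,
    by linarith⟩
  · have := (hr' hx).1.1
    simp only [Set.mem_ofPred_eq, hX0, sub_zero, one_mul] at this
    calc ‖X x‖ = ‖(X x - K (x - x₀)) + K (x - x₀)‖ := by simp
      _ ≤ ‖x - x₀‖ + ‖K‖ * ‖x - x₀‖ :=
        (norm_add_le _ _).trans (add_le_add this (K.le_opNorm _))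
      _ = (1 + ‖K‖) * ‖x - x₀‖ := by ring
      _ ≤ C * ‖x - x₀‖ := by gcongr; linarith
  · have := (hr' hx).1.2
    simp only [Set.mem_ofPred_eq] at this
    linarith

/-- A trajectory for `t < T` of `x' = X(x) + ε φ(t) Y(x)` in `U` with `x = x₀` in the past. -/
def IsForcedTrajectory (U : Set E) (X Y : E → E) (x₀ : E) (φ : ℝ → ℝ) (ε T : ℝ) (x : ℝ → E) :
    Prop :=
  (∀ᶠ t in atBot, x t = x₀) ∧
    ∀ t < T, x t ∈ U ∧ HasDerivAt x (X (x t) + (ε * φ t) • Y (x t)) t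

/-- The derivative of the trajectories with respect to the strength of the force solves the
linearized equation. -/
theorem hasDerivAt_forcedTrajectory {U : Set E} {X Y : E → E} {x₀ b : E} {K : E →L[ℝ] E}
    (hX0 : X x₀ = 0) (hX : HasFDerivAt X K x₀) (hY : ContinuousAt Y x₀) (hb : Y x₀ = b)
    {φ : ℝ → ℝ} {Φ a : ℝ} (hΦ : ∀ t, |φ t| ≤ Φ) (ha : ∀ t ≤ a, φ t = 0)
    {u : ℝ → E} (hu0 : ∀ t ≤ a, u t = 0) (hu : ∀ t, HasDerivAt u (K (u t) + φ t • b) t)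
    {T : ℝ} {x : ℝ → ℝ → E} (hx : ∀ᶠ ε in 𝓝 0, IsForcedTrajectory U X Y x₀ φ ε T (x ε))
    {t : ℝ} (ht : t < T) :
    x 0 t = x₀ ∧ HasDerivAt (fun ε => x ε t) (u t) 0 := by
  have hΦ0 : 0 ≤ Φ := (abs_nonneg _).trans (hΦ 0)
  obtain ⟨C, r, hB, -, hKC⟩ := exists_linearBound hX0 hX hY univ_mem
  have hC := hB.pos
  set L := Real.exp ((C + 1) * (t - a)) with hL
  have hL0 : 0 < L := Real.exp_pos _
  set M := C * Φ + 1 with hM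
  have hM0 : 0 < M := by positivity
  -- the trajectory from a time in the distant past
  have past : ∀ {ε}, IsForcedTrajectory U X Y x₀ φ ε T (x ε) → ∃ t₀ ≤ t, t₀ ≤ a ∧ x ε t₀ = x₀ ∧
      ContinuousOn (x ε) (Set.Icc t₀ t) ∧ ∀ s ∈ Set.Icc t₀ t,
        HasDerivAt (x ε) (X (x ε s) + (ε * φ s) • Y (x ε s)) s := by
    intro ε h
    obtain ⟨t₀, h1, h2, h3⟩ :=
      (h.1.and ((eventually_le_atBot t).and (eventually_le_atBot a))).exists
    have hd : ∀ s ∈ Set.Icc t₀ t, HasDerivAt (x ε) (X (x ε s) + (ε * φ s) • Y (x ε s)) s :=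
      fun s hs => (h.2 s (hs.2.trans_lt ht)).2
    exact ⟨t₀, h2, h3, h1, fun s hs => (hd s hs).continuousAt.continuousWithinAt, hd⟩
  -- For `ε = 0` the barrier estimate holds with every sufficiently small `δ > 0`, so the trajectory
  -- does not move.
  have zero : x 0 t = x₀ := by
    obtain ⟨t₀, h1, h2, h3, h4, h5⟩ := past hx.self_of_nhds
    have hle : ∀ δ > 0, M * δ * L ≤ r → ‖x 0 t - x₀‖ ≤ M * δ * L := fun δ hδ hr =>
      hB.norm_sub_le hΦ ha hδ (by simpa using hδ.le) hr h3 h4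
        (fun s hs => (h5 s ⟨hs.1, hs.2.le⟩).hasDerivWithinAt) ⟨h1, le_rfl⟩
    rw [← sub_eq_zero, ← norm_le_zero_iff]
    refine le_of_forall_pos_lt_add fun η hη => ?_
    rw [zero_add]
    have hm : 0 < min r (η / 2) := lt_min hB.radius_pos (by positivity)
    have e : M * (min r (η / 2) / (M * L)) * L = min r (η / 2) := by field_simp
    have := hle (min r (η / 2) / (M * L)) (by positivity) (by rw [e]; exact min_le_left _ _)
    rw [e] at this
    linarith [min_le_right r (η / 2)]
  refine ⟨zero, ?_⟩
  rw [hasDerivAt_iff_isLittleO, Asymptotics.isLittleO_iff]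
  intro c hc
  set N := M + Φ + 1 with hN
  have hN0 : 0 < N := by positivity
  -- The tolerance `η` is chosen so that the barrier `N * η * |ε| * exp((C + 1) * (s - a))` for the
  -- error `x ε - x₀ - ε • u` equals `c * |ε|` at time `t`. The remainders of `X` and `Y` contribute
  -- `(M + Φ) * η * |ε| * e`, and `N` exceeds `M + Φ` by one for strictness.
  obtain ⟨η, hη, hηc⟩ : ∃ η > 0, N * η * L = c := ⟨c / (N * L), by positivity, by field_simp⟩
  have e1 : ∀ᶠ y in 𝓝 x₀, ‖X y - X x₀ - K (y - x₀)‖ ≤ η * ‖y - x₀‖ :=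
    (Asymptotics.isLittleO_iff.mp hX.isLittleO) hη
  have e2 : ∀ᶠ y in 𝓝 x₀, ‖Y y - Y x₀‖ < η := by
    have := hY.sub (continuousAt_const (y := Y x₀))
    exact this.norm.eventually_lt continuousAt_const (by simpa using hη)
  obtain ⟨ρ, hρ, hρ'⟩ := Metric.nhds_basis_closedBall.mem_iff.mp (inter_mem e1 e2)
  have hsmall : ∀ᶠ ε : ℝ in 𝓝 0, M * |ε| * L < min r ρ := by
    have : ContinuousAt (fun ε : ℝ => M * |ε| * L) 0 := by fun_prop
    exact this.eventually_lt continuousAt_const (by simp [hB.radius_pos, hρ])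
  filter_upwards [hx, hsmall] with ε hε hsm
  rcases eq_or_ne ε 0 with rfl | hne
  · simp
  have hε0 : 0 < |ε| := abs_pos.mpr hne
  rw [zero, sub_zero, Real.norm_eq_abs]
  obtain ⟨t₀, h1, h2, h3, h4, h5⟩ := past hε
  have hy : ∀ s ∈ Set.Icc t₀ t, ‖x ε s - x₀‖ ≤ M * |ε| * Real.exp ((C + 1) * (s - a)) :=
    fun s hs => hB.norm_sub_le hΦ ha hε0 le_rfl (hsm.le.trans (min_le_left _ _)) h3 h4
        (fun s hs => (h5 s ⟨hs.1, hs.2.le⟩).hasDerivWithinAt) hs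
  have hz : ∀ s ∈ Set.Icc t₀ t, HasDerivAt (fun s => x ε s - x₀ - ε • u s)
      (X (x ε s) + (ε * φ s) • Y (x ε s) - ε • (K (u s) + φ s • b)) s := fun s hs =>
    ((h5 s hs).sub_const x₀).sub ((hu s).const_smul ε)
  have key : ‖x ε t - x₀ - ε • u t‖ ≤ N * η * |ε| * L := by
    refine norm_le_exp_of_norm_deriv_lt (z := fun s => x ε s - x₀ - ε • u s) (t₀ := t₀) (t₁ := t)
      (by positivity) (by simp [h3, hu0 _ h2])
      (fun s hs => (hz s hs).continuousAt.continuousWithinAt)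
      (fun s hs => (hz s ⟨hs.1, hs.2.le⟩).hasDerivWithinAt) (fun s hs hzs => ?_) ⟨h1, le_rfl⟩
    have hs' : s ∈ Set.Icc t₀ t := ⟨hs.1, hs.2.le⟩
    have hys := hy s hs'
    set e := Real.exp ((C + 1) * (s - a)) with he
    have he0 : 0 < e := Real.exp_pos _
    have hmem : x ε s ∈ Metric.closedBall x₀ ρ := by
      rw [mem_closedBall_iff_norm]
      refine hys.trans (le_trans ?_ (hsm.le.trans (min_le_right _ _)))
      rw [he, hL]
      gcongr
      exact hs.2.le
    obtain ⟨m1, m2⟩ := hρ' hmem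
    simp only [Set.mem_ofPred_eq, hX0, sub_zero, hb] at m1 m2
    have d1 : ‖X (x ε s) - K (x ε s - x₀)‖ ≤ η * (M * |ε| * e) := m1.trans (by gcongr)
    have d2 : ‖(ε * φ s) • (Y (x ε s) - b)‖ ≤ |ε| * Φ * η * e := by
      rcases le_or_gt s a with hsa | hsa
      · rw [ha s hsa, mul_zero, zero_smul, norm_zero]; positivity
      · have he1 : 1 ≤ e := Real.one_le_exp (mul_nonneg (by positivity) (by linarith))
        rw [norm_smul, Real.norm_eq_abs, abs_mul]
        calc |ε| * |φ s| * ‖Y (x ε s) - b‖ ≤ |ε| * Φ * η := by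
              gcongr
              exact hΦ s
          _ = |ε| * Φ * η * 1 := by ring
          _ ≤ |ε| * Φ * η * e := by gcongr
    have d3 : ‖K (x ε s - x₀ - ε • u s)‖ ≤ C * (N * η * |ε| * e) := by
      rw [← hzs]
      exact (K.le_opNorm _).trans (by gcongr)
    have split : X (x ε s) + (ε * φ s) • Y (x ε s) - ε • (K (u s) + φ s • b) =
        (X (x ε s) - K (x ε s - x₀)) + (ε * φ s) • (Y (x ε s) - b) +
          K (x ε s - x₀ - ε • u s) := by
      rw [map_sub K (x ε s - x₀), map_smul]
      module
    rw [split]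
    refine (norm_add₃_le.trans (add_le_add (add_le_add d1 d2) d3)).trans_lt ?_
    have : 0 < η * |ε| * e := by positivity
    rw [hN]
    nlinarith
  calc ‖x ε t - x₀ - ε • u t‖ ≤ N * η * |ε| * L := key
    _ = c * |ε| := by rw [← hηc]; ring

end Forced

/-! ### Existence of forced trajectories: truncation and Picard-Lindelöf. -/

section Existence

variable {n : ℕ}

/-- The retraction onto the closed ball for the supremum norm. -/
def clampBox (x₀ : Fin n → ℝ) (r : ℝ) (x : Fin n → ℝ) : Fin n → ℝ :=
  fun i => max (x₀ i - r) (min (x₀ i + r) (x i))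

theorem lipschitzWith_clampBox (x₀ : Fin n → ℝ) (r : ℝ) : LipschitzWith 1 (clampBox x₀ r) :=
  LipschitzWith.of_dist_le_mul fun x y => by
    rw [NNReal.coe_one, one_mul, dist_pi_le_iff dist_nonneg]
    intro i
    refine le_trans ?_ (dist_le_pi_dist x y i)
    have := ((LipschitzWith.id (α := ℝ)).const_min (x₀ i + r)).const_max (x₀ i - r)
    simpa [clampBox] using this.dist_le_mul (x i) (y i)

theorem clampBox_mem {x₀ : Fin n → ℝ} {r : ℝ} (hr : 0 ≤ r) (x : Fin n → ℝ) :
    clampBox x₀ r x ∈ Metric.closedBall x₀ r := by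
  rw [Metric.mem_closedBall, dist_pi_le_iff hr]
  intro i
  rw [Real.dist_eq, abs_le]
  simp only [clampBox]
  constructor
  · linarith [le_max_left (x₀ i - r) (min (x₀ i + r) (x i))]
  · have : max (x₀ i - r) (min (x₀ i + r) (x i)) ≤ x₀ i + r :=
      max_le (by linarith) (min_le_left _ _)
    linarith

theorem clampBox_eq {x₀ x : Fin n → ℝ} {r : ℝ} (hx : x ∈ Metric.closedBall x₀ r) :
    clampBox x₀ r x = x := by
  funext i
  have := (dist_le_pi_dist x x₀ i).trans hx
  rw [Real.dist_eq, abs_le] at this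
  simp only [clampBox]
  rw [min_eq_right (by linarith), max_eq_right (by linarith)]

/-- A weak force keeps the trajectory near the equilibrium up to any given time. -/
theorem exists_forcedTrajectory {U : Set (Fin n → ℝ)} {X Y : (Fin n → ℝ) → Fin n → ℝ}
    {x₀ : Fin n → ℝ} (hU : U ∈ 𝓝 x₀) (hX0 : X x₀ = 0) (hX : ContDiffAt ℝ 1 X x₀)
    (hY : ContDiffAt ℝ 1 Y x₀) {φ : ℝ → ℝ} {Φ a : ℝ} (hφ : Continuous φ)
    (hΦ : ∀ t, |φ t| ≤ Φ) (ha : ∀ t ≤ a, φ t = 0) (T : ℝ) :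
    ∀ᶠ ε in 𝓝 (0 : ℝ), ∃ x, IsForcedTrajectory U X Y x₀ φ ε T x := by
  have hΦ0 : 0 ≤ Φ := (abs_nonneg _).trans (hΦ 0)
  obtain ⟨LX, sX, hsX, hLX⟩ := hX.exists_lipschitzOnWith
  obtain ⟨LY, sY, hsY, hLY⟩ := hY.exists_lipschitzOnWith
  obtain ⟨C, r, hB, hsub, -⟩ := exists_linearBound hX0
    (hX.differentiableAt one_ne_zero).hasFDerivAt hY.continuousAt
    (inter_mem (inter_mem hsX hsY) hU)
  have hC := hB.pos
  have hr := hB.radius_pos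
  -- The equation is solved on `[a, T']`, which extends beyond `T`; before `a` the trajectory is
  -- constant.
  set T' := max T a + 1 with hT'
  have haT : a < T' := by linarith [le_max_right T a]
  obtain ⟨δ, hδ, hδr⟩ : ∃ δ > 0, (C * Φ + 1) * δ * Real.exp ((C + 1) * (T' - a)) ≤ r :=
    ⟨r / ((C * Φ + 1) * Real.exp ((C + 1) * (T' - a))), by positivity, by
      apply le_of_eq; field_simp⟩
  have hδ' : ∀ᶠ ε : ℝ in 𝓝 0, |ε| < δ :=
    continuous_abs.continuousAt.eventually_lt continuousAt_const (by simpa using hδ)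
  filter_upwards [hδ'] with ε hε
  -- The truncated fields are bounded and globally Lipschitz, so one Picard-Lindelöf step covers the
  -- whole interval. The barrier estimate then keeps the solution in the ball, where truncation
  -- changes nothing.
  set X' : (Fin n → ℝ) → Fin n → ℝ := fun x => X (clampBox x₀ r x) with hX'
  set Y' : (Fin n → ℝ) → Fin n → ℝ := fun x => Y (clampBox x₀ r x) with hY'
  have cl := fun x => clampBox_mem (x₀ := x₀) hr.le x
  have hB' : LinearBound X' Y' x₀ C r :=
    ⟨hC, hr, fun x hx => by simpa only [hX', clampBox_eq hx] using hB.field x hx,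
      fun x hx => by simpa only [hY', clampBox_eq hx] using hB.force x hx⟩
  have lX : LipschitzWith LX X' := by
    have := hLX.comp (lipschitzWith_clampBox x₀ r).lipschitzOnWith
      (s := Set.univ) (fun x _ => (hsub (cl x)).1.1)
    rw [mul_one] at this
    exact lipschitzOnWith_univ.mp this
  have lY : LipschitzWith LY Y' := by
    have := hLY.comp (lipschitzWith_clampBox x₀ r).lipschitzOnWith
      (s := Set.univ) (fun x _ => (hsub (cl x)).1.2)
    rw [mul_one] at this
    exact lipschitzOnWith_univ.mp this
  obtain ⟨B, hBdef⟩ : ∃ B : NNReal, (B : ℝ) = C * r + |ε| * Φ * C := ⟨⟨_, by positivity⟩, rfl⟩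
  obtain ⟨τ, hτ⟩ : ∃ τ : NNReal, (τ : ℝ) = T' - a := ⟨⟨_, by linarith⟩, rfl⟩
  obtain ⟨q, hq⟩ : ∃ q : NNReal, (q : ℝ) = |ε| * Φ := ⟨⟨_, by positivity⟩, rfl⟩
  have hf : ∀ t, ∀ x, ‖X' x + (ε * φ t) • Y' x‖ ≤ B := by
    intro t x
    rw [hBdef]
    refine (norm_add_le _ _).trans (add_le_add ?_ ?_)
    · refine (hB.field _ (cl x)).trans ?_
      gcongr
      exact mem_closedBall_iff_norm.mp (cl x)
    · rw [norm_smul, Real.norm_eq_abs, abs_mul]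
      gcongr
      · exact hΦ t
      · exact hB.force _ (cl x)
  have hPL : IsPicardLindelof (fun t x => X' x + (ε * φ t) • Y' x)
      (⟨a, le_rfl, haT.le⟩ : Set.Icc a T') x₀ (B * τ) 0 B (LX + q * LY) := by
    refine ⟨fun t _ => LipschitzWith.lipschitzOnWith ?_, fun x _ => ?_, fun t _ x _ => hf t x, ?_⟩
    · refine LipschitzWith.of_dist_le_mul fun x y => ?_
      have h1 := lX.dist_le_mul x y
      have h2 := lY.dist_le_mul x y
      rw [dist_eq_norm] at h1 h2 ⊢
      calc ‖X' x + (ε * φ t) • Y' x - (X' y + (ε * φ t) • Y' y)‖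
          = ‖(X' x - X' y) + (ε * φ t) • (Y' x - Y' y)‖ := by congr 1; module
        _ ≤ LX * dist x y + (|ε| * Φ) * (LY * dist x y) := by
          refine (norm_add_le _ _).trans (add_le_add h1 ?_)
          rw [norm_smul, Real.norm_eq_abs, abs_mul]
          gcongr
          exact hΦ t
        _ = (LX + q * LY : NNReal) * dist x y := by
          push_cast; rw [hq]; ring
    · fun_prop
    · simp [hτ, max_eq_left (sub_nonneg.mpr haT.le)]
  obtain ⟨α, hα0, hα⟩ := hPL.exists_eq_forall_mem_Icc_hasDerivWithinAt₀
  have hα0' : α a = x₀ := hα0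
  have hαI : ∀ t ∈ Set.Ico a T',
      HasDerivWithinAt α (X' (α t) + (ε * φ t) • Y' (α t)) (Set.Ici t) t := fun t ht =>
    (hα t ⟨ht.1, ht.2.le⟩).mono_of_mem_nhdsWithin
      (mem_of_superset (Icc_mem_nhdsGE ht.2) (Set.Icc_subset_Icc_left ht.1))
  have hαball : ∀ t ∈ Set.Icc a T', α t ∈ Metric.closedBall x₀ r := by
    intro t ht
    rw [mem_closedBall_iff_norm]
    refine (hB'.norm_sub_le hΦ ha hδ hε.le hδr hα0'
      (fun s hs => (hα s hs).continuousWithinAt) hαI ht).trans (le_trans ?_ hδr)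
    gcongr
    exact ht.2
  set x : ℝ → Fin n → ℝ := fun t => if t ≤ a then x₀ else α t with hx
  have hxle : ∀ t ≤ a, x t = x₀ := fun t ht => by simp [hx, ht]
  have hxge : ∀ t, a ≤ t → x t = α t := fun t ht => by
    rcases ht.eq_or_lt with rfl | h
    · simp [hx, hα0']
    · simp [hx, not_le.mpr h]
  have h0U : x₀ ∈ U := mem_of_mem_nhds hU
  refine ⟨x, (eventually_le_atBot a).mono hxle, fun t htT => ?_⟩
  have htT' : t < T' := by linarith [le_max_left T a]
  have left : ∀ t ≤ a, HasDerivWithinAt x (X (x t) + (ε * φ t) • Y (x t)) (Set.Iic a) t := by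
    intro t ht
    rw [hxle t ht, hX0, ha t ht]
    simp only [mul_zero, zero_smul, add_zero]
    exact (hasDerivWithinAt_const t (Set.Iic a) x₀).congr (fun s hs => hxle s hs) (hxle t ht)
  have right : ∀ t, a ≤ t → t < T' →
      HasDerivWithinAt x (X (x t) + (ε * φ t) • Y (x t)) (Set.Icc a T') t := by
    intro t ht htT'
    have hmem : t ∈ Set.Icc a T' := ⟨ht, htT'.le⟩
    have := hα t hmem
    simp only [hX', hY', clampBox_eq (hαball t hmem)] at this
    rw [hxge t ht]
    exact this.congr (fun s hs => hxge s hs.1) (hxge t ht)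
  rcases lt_trichotomy t a with h | h | h
  · exact ⟨by rwa [hxle t h.le], (left t h.le).hasDerivAt (Iic_mem_nhds h)⟩
  · refine ⟨by rwa [hxle t h.le], ?_⟩
    -- At the gluing time both one-sided derivatives agree, because the same formula for the
    -- velocity is used on either side.
    have hu := (left t h.le).union (right t h.ge htT')
    refine hu.hasDerivAt ?_
    rw [h, Set.Iic_union_Icc_eq_Iic haT.le]
    exact Iic_mem_nhds haT
  · refine ⟨?_, (right t h.le htT').hasDerivAt (Icc_mem_nhds h htT')⟩
    rw [hxge t h.le]
    exact (hsub (hαball t ⟨h.le, htT'.le⟩)).2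

end Existence

/-! ### Eigenvectors of the generator -/

section Eigen

variable {n : ℕ}

/-- The complexification of a real matrix. -/
abbrev complexify {m : ℕ} (M : Matrix (Fin m) (Fin n) ℝ) : Matrix (Fin m) (Fin n) ℂ :=
  M.map ((↑) : ℝ → ℂ)

theorem complexify_mul {m k : ℕ} (M : Matrix (Fin m) (Fin n) ℝ) (N : Matrix (Fin n) (Fin k) ℝ) :
    complexify (M * N) = complexify M * complexify N :=
  Matrix.map_mul (f := Complex.ofRealHom)

theorem complexify_neg (M : Matrix (Fin n) (Fin n) ℝ) : complexify (-M) = -complexify M := by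
  ext; simp

theorem complexify_conjTranspose (M : Matrix (Fin n) (Fin n) ℝ) :
    (complexify M).conjTranspose = complexify M.transpose := by
  ext; simp

theorem star_complexify_mulVec (M : Matrix (Fin n) (Fin n) ℝ) (v : Fin n → ℂ) :
    star ((complexify M).mulVec v) = (complexify M).mulVec (star v) := by
  ext; simp [Matrix.mulVec, dotProduct]

theorem complexify_mulVec_ofReal (M : Matrix (Fin n) (Fin n) ℝ) (v : Fin n → ℝ) :
    (complexify M).mulVec (fun i => (v i : ℂ)) = fun i => ((M.mulVec v i : ℝ) : ℂ) := by
  ext; simp [Matrix.mulVec, dotProduct]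

theorem star_dotProduct_complexify_mulVec (M : Matrix (Fin n) (Fin n) ℝ) (v v' : Fin n → ℂ) :
    star v ⬝ᵥ (complexify M).mulVec v' = star ((complexify M.transpose).mulVec v) ⬝ᵥ v' := by
  rw [Matrix.star_mulVec, complexify_conjTranspose, Matrix.transpose_transpose,
    Matrix.dotProduct_mulVec]

/-- The algebraic data of the linearized evolution `K = -W A`: a positive definite Hessian `A`, an
antisymmetric form `w` and its antisymmetric pseudo-inverse `W`. -/
structure LinearizedData (w W A : Matrix (Fin n) (Fin n) ℝ) : Prop where
  posDef : A.PosDef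
  form_transpose : w.transpose = -w
  inv_transpose : W.transpose = -W
  outer_inverse : W * w * W = W

variable {w W A : Matrix (Fin n) (Fin n) ℝ}

/-- An orthonormal basis for the Hessian that consists of eigenvectors of the generator. -/
theorem LinearizedData.exists_eigenbasis (h : LinearizedData w W A) :
    ∃ (d : Fin n → ℝ) (v : Fin n → Fin n → ℂ),
      (∀ j, (complexify (-(W * A))).mulVec (v j) = (Complex.I * (d j : ℂ)) • v j) ∧
      (∀ j k, star (v j) ⬝ᵥ (complexify A).mulVec (v k) = if j = k then 1 else 0) ∧
      ∀ x, x = ∑ k, (star (v k) ⬝ᵥ (complexify A).mulVec x) • v k := by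
  obtain ⟨S, hS, hAS⟩ : ∃ S : Matrix (Fin n) (Fin n) ℝ, IsUnit S ∧ A = S.transpose * S := by
    open scoped MatrixOrder Matrix.Norms.L2Operator in
    obtain ⟨S, hS⟩ := CStarAlgebra.nonneg_iff_eq_star_mul_self.mp h.posDef.posSemidef.nonneg
    rw [Matrix.star_eq_conjTranspose, Matrix.conjTranspose_eq_transpose_of_trivial] at hS
    refine ⟨S, ?_, hS⟩
    rw [Matrix.isUnit_iff_isUnit_det, isUnit_iff_ne_zero]
    intro h0
    have := h.posDef.det_pos
    rw [hS, Matrix.det_mul, h0, mul_zero] at this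
    exact lt_irrefl _ this
  have hdet : IsUnit S.det := (Matrix.isUnit_iff_isUnit_det _).mp hS
  -- `M = S K S⁻¹` is real antisymmetric, so `-i M` is Hermitian. Pulling its orthonormal eigenbasis
  -- back by `S⁻¹` gives an `A`-orthonormal one, as `A = SᵀS`.
  set M : Matrix (Fin n) (Fin n) ℝ := -(S * W * S.transpose) with hM
  have hMT : M.transpose = -M := by
    rw [hM]; simp [Matrix.transpose_mul, h.inv_transpose, Matrix.mul_assoc]
  have hN : ((-Complex.I) • complexify M).IsHermitian := by
    rw [Matrix.IsHermitian, Matrix.conjTranspose_smul, complexify_conjTranspose, hMT,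
      complexify_neg]
    simp
  have hSK : S * -(W * A) = M * S := by
    rw [hM, hAS]; simp [Matrix.mul_assoc]
  have hSc : complexify S⁻¹ * complexify S = 1 := by
    rw [← complexify_mul, Matrix.nonsing_inv_mul _ hdet]
    ext i j; simp only [Matrix.map_apply, Matrix.one_apply]; split_ifs <;> simp
  have hSc' : complexify S * complexify S⁻¹ = 1 := by
    rw [← complexify_mul, Matrix.mul_nonsing_inv _ hdet]
    ext i j; simp only [Matrix.map_apply, Matrix.one_apply]; split_ifs <;> simp
  set B := hN.eigenvectorBasis
  set u : Fin n → Fin n → ℂ := fun j => (B j).ofLp with hu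
  have hMu : ∀ j, (complexify M).mulVec (u j) = (Complex.I * (hN.eigenvalues j : ℂ)) • u j := by
    intro j
    have h1 : ((-Complex.I) • complexify M).mulVec (u j) = hN.eigenvalues j • u j :=
      hN.mulVec_eigenvectorBasis j
    have h2 := congrArg (fun y => Complex.I • y) h1
    simp only [Matrix.smul_mulVec, smul_smul] at h2
    simp only [mul_neg, Complex.I_mul_I, neg_neg, one_smul] at h2
    rw [h2]
    ext i; simp [mul_assoc]
  have hinner : ∀ x y : Fin n → ℂ, star x ⬝ᵥ (complexify A).mulVec y =
      star ((complexify S).mulVec x) ⬝ᵥ (complexify S).mulVec y := by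
    intro x y
    rw [hAS, complexify_mul, ← Matrix.mulVec_mulVec, star_dotProduct_complexify_mulVec,
      Matrix.transpose_transpose]
  have hSv : ∀ j, (complexify S).mulVec ((complexify S⁻¹).mulVec (u j)) = u j := by
    intro j; rw [Matrix.mulVec_mulVec, hSc', Matrix.one_mulVec]
  have hB : ∀ (j : Fin n) (y : Fin n → ℂ), star (u j) ⬝ᵥ y = inner ℂ (B j) (WithLp.toLp 2 y) := by
    intro j y
    rw [EuclideanSpace.inner_eq_star_dotProduct, dotProduct_comm]
  refine ⟨hN.eigenvalues, fun j => (complexify S⁻¹).mulVec (u j), fun j => ?_, fun j k => ?_,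
    fun x => ?_⟩
  · have h1 : (complexify S).mulVec ((complexify (-(W * A))).mulVec ((complexify S⁻¹).mulVec (u j)))
        = (Complex.I * (hN.eigenvalues j : ℂ)) • u j := by
      rw [Matrix.mulVec_mulVec, ← complexify_mul, hSK, complexify_mul, ← Matrix.mulVec_mulVec, hSv,
        hMu]
    have h2 := congrArg (complexify S⁻¹).mulVec h1
    rwa [Matrix.mulVec_mulVec, hSc, Matrix.one_mulVec, Matrix.mulVec_smul] at h2
  · rw [hinner, hSv, hSv, hB]
    exact orthonormal_iff_ite.mp B.orthonormal j k
  · have h1 := B.sum_repr' (WithLp.toLp 2 ((complexify S).mulVec x))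
    have h2 := congrArg (fun y : EuclideanSpace ℂ (Fin n) => (complexify S⁻¹).mulVec y.ofLp) h1
    simp only [WithLp.ofLp_sum, WithLp.ofLp_smul] at h2
    rw [Matrix.mulVec_mulVec, hSc, Matrix.one_mulVec, Matrix.mulVec_sum] at h2
    conv_lhs => rw [← h2]
    refine Finset.sum_congr rfl fun k _ => ?_
    rw [Matrix.mulVec_smul, hinner, hSv, hB]

/-- A non-zero eigenvalue puts `v` into the range of `W`, on which `W * w` is the identity by the
outer inverse condition. This replaces invertibility of `w`. -/
theorem LinearizedData.inv_mul_form_mulVec {v : Fin n → ℂ} {c : ℂ} (h : LinearizedData w W A)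
    (hc : c ≠ 0) (hv : (complexify (-(W * A))).mulVec v = c • v) :
    (complexify (W * w)).mulVec v = v := by
  have h1 : v = c⁻¹ • (complexify (-(W * A))).mulVec v := by
    rw [hv, smul_smul, inv_mul_cancel₀ hc, one_smul]
  have h2 : W * w * -(W * A) = -(W * A) := by
    rw [Matrix.mul_neg, ← Matrix.mul_assoc, h.outer_inverse]
  rw [h1, Matrix.mulVec_smul, Matrix.mulVec_mulVec, ← complexify_mul, h2]

/-- `v^* w W = v^*` for an eigenvector `v`. -/
theorem LinearizedData.star_dotProduct_form_mulVec {v : Fin n → ℂ} {c : ℂ}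
    (h : LinearizedData w W A) (hc : c ≠ 0) (hv : (complexify (-(W * A))).mulVec v = c • v)
    (x : Fin n → ℂ) :
    star v ⬝ᵥ (complexify w).mulVec ((complexify W).mulVec x) = star v ⬝ᵥ x := by
  have hT : (w * W).transpose = W * w := by
    rw [Matrix.transpose_mul, h.form_transpose, h.inv_transpose]; simp
  rw [Matrix.mulVec_mulVec, ← complexify_mul, star_dotProduct_complexify_mulVec, hT,
    h.inv_mul_form_mulVec hc hv]

/-- On eigenvectors, `w` and the Hessian are proportional. -/
theorem LinearizedData.form_eq_hessian {v v' : Fin n → ℂ} {c : ℂ} {d : ℝ}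
    (h : LinearizedData w W A) (hc : c ≠ 0) (hv : (complexify (-(W * A))).mulVec v = c • v)
    (hd : d ≠ 0) (hv' : (complexify (-(W * A))).mulVec v' = (Complex.I * (d : ℂ)) • v') :
    star v ⬝ᵥ (complexify w).mulVec v' =
      (Complex.I / d) * (star v ⬝ᵥ (complexify A).mulVec v') := by
  have hd' : (d : ℂ) ≠ 0 := by exact_mod_cast hd
  -- Replacing `i d v'` by `-W A v'` turns the left side into `-v^* w W A v'`, and `v^* w W = v^*`.
  have h1 : (Complex.I * d) * (star v ⬝ᵥ (complexify w).mulVec v') =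
      -(star v ⬝ᵥ (complexify A).mulVec v') := by
    rw [← h.star_dotProduct_form_mulVec hc hv ((complexify A).mulVec v'), ← smul_eq_mul,
      ← dotProduct_smul, ← Matrix.mulVec_smul, ← hv', complexify_neg, complexify_mul,
      Matrix.neg_mulVec, Matrix.mulVec_neg, dotProduct_neg, Matrix.mulVec_mulVec v' (complexify W)]
  have h2 : star v ⬝ᵥ (complexify A).mulVec v' =
      -((Complex.I * d) * (star v ⬝ᵥ (complexify w).mulVec v')) := by rw [h1, neg_neg]
  rw [h2]
  field_simp
  linear_combination (star v ⬝ᵥ (complexify w).mulVec v') * Complex.I_sq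

/-- Eigenvectors with different frequencies are orthogonal for the Hessian. -/
theorem LinearizedData.orthogonal {v v' : Fin n → ℂ} {d d' : ℝ} (h : LinearizedData w W A)
    (hv : (complexify (-(W * A))).mulVec v = (Complex.I * (d : ℂ)) • v)
    (hv' : (complexify (-(W * A))).mulVec v' = (Complex.I * (d' : ℂ)) • v') (hd : d ≠ d') :
    star v ⬝ᵥ (complexify A).mulVec v' = 0 := by
  have hA : A.transpose = A := by
    have := h.posDef.isHermitian.eq
    rwa [Matrix.conjTranspose_eq_transpose_of_trivial] at this
  -- `A K` is antisymmetric, so `K` is skew-adjoint for the Hessian inner product. Evaluating `v^* A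
  -- K v'` on either side gives the orthogonality.
  have hT : (A * -(W * A)).transpose = -(A * -(W * A)) := by
    simp [Matrix.transpose_mul, hA, h.inv_transpose, Matrix.mul_assoc]
  have h1 : star v ⬝ᵥ (complexify (A * -(W * A))).mulVec v' =
      (Complex.I * d') * (star v ⬝ᵥ (complexify A).mulVec v') := by
    rw [complexify_mul, ← Matrix.mulVec_mulVec, hv', Matrix.mulVec_smul, dotProduct_smul,
      smul_eq_mul]
  have h2 : star v ⬝ᵥ (complexify (A * -(W * A))).mulVec v' =
      (Complex.I * d) * (star v ⬝ᵥ (complexify A).mulVec v') := by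
    rw [star_dotProduct_complexify_mulVec, hT, complexify_neg, complexify_mul, Matrix.neg_mulVec,
      ← Matrix.mulVec_mulVec, hv, Matrix.mulVec_smul, star_dotProduct_complexify_mulVec, hA]
    simp
  have h3 : (Complex.I * (d - d')) * (star v ⬝ᵥ (complexify A).mulVec v') = 0 := by
    linear_combination h1 - h2
  refine (mul_eq_zero.mp h3).resolve_left (mul_ne_zero Complex.I_ne_zero ?_)
  rw [sub_ne_zero]
  exact_mod_cast hd

theorem eigen_star {K : Matrix (Fin n) (Fin n) ℝ} {v : Fin n → ℂ} {d : ℝ}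
    (hv : (complexify K).mulVec v = (Complex.I * (d : ℂ)) • v) :
    (complexify K).mulVec (star v) = (Complex.I * ((-d : ℝ) : ℂ)) • star v := by
  rw [← star_complexify_mulVec, hv, star_smul]
  simp

/-- The range of the generator is spanned by eigenvectors with non-zero eigenvalues. -/
theorem LinearizedData.mulVec_mem {P : Submodule ℂ (Fin n → ℂ)} (h : LinearizedData w W A)
    (hP : ∀ (c : ℂ) (v : Fin n → ℂ), c ≠ 0 → (complexify (-(W * A))).mulVec v = c • v → v ∈ P)
    (x : Fin n → ℂ) : (complexify (-(W * A))).mulVec x ∈ P := by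
  obtain ⟨d, v, hv, -, hx⟩ := h.exists_eigenbasis
  rw [hx x, Matrix.mulVec_sum]
  refine Submodule.sum_mem _ fun k _ => ?_
  rw [Matrix.mulVec_smul, hv]
  refine Submodule.smul_mem _ _ ?_
  by_cases h0 : (Complex.I * (d k : ℂ)) = 0
  · rw [h0, zero_smul]; exact Submodule.zero_mem _
  · exact Submodule.smul_mem _ _ (hP _ _ h0 (hv k))

/-- A complete normalized eigensystem made of conjugate pairs. -/
theorem LinearizedData.exists_eigensystem (h : LinearizedData w W A) :
    ∃ (m : ℕ) (freq : Fin m → ℝ) (e : Fin m → Fin n → ℂ), (∀ l, 0 < freq l) ∧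
      IsNormalizedEigensystem w (-(W * A)) (Sum.elim freq fun l => -freq l)
        (Sum.elim e fun l => star (e l)) := by
  obtain ⟨d, v, hv, hon, hx⟩ := h.exists_eigenbasis
  let σ : Fin (Fintype.card {j // 0 < d j}) ≃ {j // 0 < d j} := (Fintype.equivFin _).symm
  have hpos : ∀ l, 0 < d (σ l) := fun l => (σ l).2
  -- The factor `√d` gives squared Hessian norm `d`, which cancels the denominator of the
  -- proportionality `i / d` between `w` and `A`.
  set e : Fin (Fintype.card {j // 0 < d j}) → Fin n → ℂ :=
    fun l => ((Real.sqrt (d (σ l)) : ℝ) : ℂ) • v (σ l) with he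
  have hee : ∀ l, (complexify (-(W * A))).mulVec (e l) = (Complex.I * (d (σ l) : ℂ)) • e l := by
    intro l
    simp only [he]
    rw [Matrix.mulVec_smul, hv, smul_comm]
  have hee' : ∀ l, (complexify (-(W * A))).mulVec (star (e l)) =
      (Complex.I * ((-d (σ l) : ℝ) : ℂ)) • star (e l) := fun l => eigen_star (hee l)
  have hIc : ∀ {r : ℝ}, r ≠ 0 → Complex.I * (r : ℂ) ≠ 0 := fun hr =>
    mul_ne_zero Complex.I_ne_zero (by exact_mod_cast hr)
  have hAe : ∀ l m, star (e l) ⬝ᵥ (complexify A).mulVec (e m) =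
      if l = m then (d (σ l) : ℂ) else 0 := by
    intro l m
    simp only [he]
    rw [Matrix.mulVec_smul, star_smul, smul_dotProduct, dotProduct_smul, hon]
    by_cases hlm : l = m
    · subst hlm
      simp only [if_true, smul_eq_mul, mul_one, Complex.star_def, Complex.conj_ofReal]
      rw [← Complex.ofReal_mul, Real.mul_self_sqrt (hpos l).le]
    · have : ¬ ((σ l : Fin n) = σ m) := fun hh => hlm (σ.injective (Subtype.ext hh))
      simp [this, hlm]
  have hAe' : ∀ l m, star (star (e l)) ⬝ᵥ (complexify A).mulVec (star (e m)) =
      if l = m then (d (σ l) : ℂ) else 0 := by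
    intro l m
    rw [← star_complexify_mulVec, Matrix.star_dotProduct_star, dotProduct_comm, hAe]
    split_ifs <;> simp
  refine ⟨_, fun l => d (σ l), e, hpos, ?_, ?_, ?_, ?_⟩
  · rintro (l | l)
    · exact (hpos l).ne'
    · exact neg_ne_zero.mpr (hpos l).ne'
  · rintro (l | l)
    · exact hee l
    · exact hee' l
  · rintro (l | l) (m | m)
    · have hm := (hpos m).ne'
      have hm' : (d (σ m) : ℂ) ≠ 0 := by exact_mod_cast hm
      simp only [Sum.elim_inl, Sum.inl.injEq]
      rw [h.form_eq_hessian (hIc (hpos l).ne') (hee l) hm (hee m), hAe,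
        Real.sign_of_pos (hpos l)]
      split_ifs with hlm
      · subst hlm; field_simp; simp
      · simp
    · have hne : d (σ l) ≠ -d (σ m) := by linarith [hpos l, hpos m]
      simp only [Sum.elim_inl, Sum.elim_inr, reduceCtorEq, if_false]
      rw [h.form_eq_hessian (hIc (hpos l).ne') (hee l) (neg_ne_zero.mpr (hpos m).ne') (hee' m),
        h.orthogonal (hee l) (hee' m) hne, mul_zero]
    · have hne : -d (σ l) ≠ d (σ m) := by linarith [hpos l, hpos m]
      simp only [Sum.elim_inl, Sum.elim_inr, reduceCtorEq, if_false]
      rw [h.form_eq_hessian (hIc (neg_ne_zero.mpr (hpos l).ne')) (hee' l) (hpos m).ne' (hee m),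
        h.orthogonal (hee' l) (hee m) hne, mul_zero]
    · have hm := (hpos m).ne'
      have hm' : (d (σ m) : ℂ) ≠ 0 := by exact_mod_cast hm
      simp only [Sum.elim_inr, Sum.inr.injEq]
      rw [h.form_eq_hessian (hIc (neg_ne_zero.mpr (hpos l).ne')) (hee' l) (neg_ne_zero.mpr hm)
        (hee' m), hAe', Real.sign_of_neg (neg_neg_of_pos (hpos l))]
      split_ifs with hlm
      · subst hlm; push_cast; field_simp
      · simp
  · set P := Submodule.span ℂ (Set.range (Sum.elim e fun l => star (e l))) with hP
    have hpv : ∀ k, 0 < d k → v k ∈ P ∧ star (v k) ∈ P := by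
      intro k hk
      have hs : ((Real.sqrt (d k) : ℝ) : ℂ) ≠ 0 := by
        exact_mod_cast (Real.sqrt_pos.mpr hk).ne'
      have hk' : ((σ (σ.symm ⟨k, hk⟩) : {j // 0 < d j}) : Fin n) = k := by simp
      have hek : e (σ.symm ⟨k, hk⟩) = ((Real.sqrt (d k) : ℝ) : ℂ) • v k := by
        simp only [he, hk']
      constructor
      · have h1 : e (σ.symm ⟨k, hk⟩) ∈ P := Submodule.subset_span ⟨Sum.inl _, rfl⟩
        rw [hek] at h1
        exact (Submodule.smul_mem_iff _ hs).mp h1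
      · have h1 : star (e (σ.symm ⟨k, hk⟩)) ∈ P := Submodule.subset_span ⟨Sum.inr _, rfl⟩
        rw [hek, star_smul] at h1
        exact (Submodule.smul_mem_iff _ (by simpa using hs)).mp h1
    have hv0 : ∀ k, d k ≠ 0 → v k ∈ P := by
      intro k hk
      rcases hk.lt_or_gt with hk | hk
      -- The conjugate of an eigenvector with negative frequency has positive frequency `-d k`. By
      -- orthogonality its expansion involves only basis vectors of that frequency; conjugating back
      -- expresses `v k` through their conjugates.
      · have h1 := congrArg star (hx (star (v k)))
        rw [star_star, star_sum] at h1
        rw [h1]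
        refine Submodule.sum_mem _ fun j _ => ?_
        rw [star_smul]
        by_cases hj : d j = -d k
        · exact Submodule.smul_mem _ _ (hpv j (by linarith)).2
        · rw [h.orthogonal (hv j) (eigen_star (hv k)) hj, star_zero, zero_smul]
          exact Submodule.zero_mem _
      · exact (hpv k hk).1
    intro c y hc hy
    have h1 : y = c⁻¹ • (complexify (-(W * A))).mulVec y := by
      rw [hy, smul_smul, inv_mul_cancel₀ hc, one_smul]
    rw [h1, hx y, Matrix.mulVec_sum]
    refine Submodule.smul_mem _ _ (Submodule.sum_mem _ fun k _ => ?_)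
    rw [Matrix.mulVec_smul, hv]
    refine Submodule.smul_mem _ _ ?_
    by_cases h0 : d k = 0
    · rw [h0]; simp
    · exact Submodule.smul_mem _ _ (hv0 k h0)

/-- The expansion of the force `-W g` in a complete normalized eigensystem. -/
theorem LinearizedData.force_eq_sum (h : LinearizedData w W A) {ι : Type} [Fintype ι]
    [DecidableEq ι] {freq : ι → ℝ} {e : ι → Fin n → ℂ}
    (he : IsNormalizedEigensystem w (-(W * A)) freq e) (g : Fin n → ℝ) :
    (fun i => (((-W.mulVec g) i : ℝ) : ℂ)) =
      ∑ l, (Complex.I * (Real.sign (freq l) : ℂ) * star (∑ μ, e l μ * (g μ : ℂ))) • e l := by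
  have hAdet : IsUnit A.det := h.posDef.det_pos.ne'.isUnit
  set b : Fin n → ℂ := fun i => (((-W.mulVec g) i : ℝ) : ℂ) with hb
  -- `-W g = K (A⁻¹ g)` lies in the range of `K`, hence in the span of the eigensystem.
  have hbK : b = (complexify (-(W * A))).mulVec (fun i => ((A⁻¹.mulVec g i : ℝ) : ℂ)) := by
    rw [complexify_mulVec_ofReal]
    simp only [hb, Matrix.mulVec_mulVec]
    rw [Matrix.neg_mul, Matrix.mul_assoc, Matrix.mul_nonsing_inv _ hAdet, Matrix.mul_one,
      Matrix.neg_mulVec]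
  have hbW : b = -(complexify W).mulVec (fun i => (g i : ℂ)) := by
    rw [complexify_mulVec_ofReal]; ext i; simp [hb]
  have hmem : b ∈ Submodule.span ℂ (Set.range e) := by
    rw [hbK]; exact h.mulVec_mem he.complete _
  obtain ⟨c, hc⟩ := (Submodule.mem_span_range_iff_exists_fun ℂ).mp hmem
  rw [← hc]
  refine Finset.sum_congr rfl fun l _ => ?_
  congr 1
  have hl := he.freq_ne_zero l
  have hlc : Complex.I * (freq l : ℂ) ≠ 0 :=
    mul_ne_zero Complex.I_ne_zero (by exact_mod_cast hl)
  -- The pairing of `e l` with `b` under `w` is computed twice, from the normalization and from `v^*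
  -- w W = v^*`; comparison determines `c l`.
  have h1 : star (e l) ⬝ᵥ (complexify w).mulVec b = Complex.I * (Real.sign (freq l) : ℂ) * c l := by
    rw [← hc, Matrix.mulVec_sum, dotProduct_sum, Finset.sum_eq_single l]
    · rw [Matrix.mulVec_smul, dotProduct_smul, he.normalized, if_pos rfl, smul_eq_mul, mul_comm]
    · intro m _ hm
      rw [Matrix.mulVec_smul, dotProduct_smul, he.normalized, if_neg hm.symm, smul_zero]
    · simp
  have h2 : star (e l) ⬝ᵥ (complexify w).mulVec b = -star (∑ μ, e l μ * (g μ : ℂ)) := by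
    rw [hbW, Matrix.mulVec_neg, dotProduct_neg, h.star_dotProduct_form_mulVec hlc (he.eigen l)]
    simp [dotProduct]
  have hsq : (Real.sign (freq l) : ℂ) * (Real.sign (freq l) : ℂ) = 1 := by
    rcases hl.lt_or_gt with hl | hl
    · rw [Real.sign_of_neg hl]; simp
    · rw [Real.sign_of_pos hl]; simp
  have h3 := h1.symm.trans h2
  linear_combination (-(Complex.I * (Real.sign (freq l) : ℂ))) * h3 - (c l) * hsq +
    c l * (Real.sign (freq l) : ℂ) * (Real.sign (freq l) : ℂ) * Complex.I_sq

end Eigen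

/-! ### The linearized response -/

section LinearizedResponse

variable {n : ℕ} {ι : Type} [Fintype ι]

/-- The response function `χ(t) = ∑_ℓ i κ_ℓ exp(i ω_ℓ t)`. -/
noncomputable def responseFunction (freq κ : ι → ℝ) (t : ℝ) : ℂ :=
  ∑ l, Complex.I * (κ l : ℂ) * Complex.exp (Complex.I * freq l * t)

theorem continuous_responseFunction (freq κ : ι → ℝ) : Continuous (responseFunction freq κ) := by
  unfold responseFunction; fun_prop

theorem norm_responseFunction_le (freq κ : ι → ℝ) (t : ℝ) :
    ‖responseFunction freq κ t‖ ≤ ∑ l, |κ l| := by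
  refine norm_sum_le_of_le _ fun l _ => ?_
  rw [norm_mul, norm_mul, mul_assoc Complex.I, mul_comm Complex.I, ← Complex.ofReal_mul,
    Complex.norm_exp_ofReal_mul_I]
  simp

/-- The free evolution with initial value `∑ c_ℓ e_ℓ`. -/
noncomputable def freeEvolution (freq : ι → ℝ) (e : ι → Fin n → ℂ) (c : ι → ℂ) (t : ℝ) :
    Fin n → ℂ :=
  ∑ l, (c l * Complex.exp (Complex.I * freq l * t)) • e l

theorem hasDerivAt_exp_freq (ω t : ℝ) :
    HasDerivAt (fun t : ℝ => Complex.exp (Complex.I * ω * t))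
      (Complex.I * ω * Complex.exp (Complex.I * ω * t)) t := by
  have h : HasDerivAt (fun t : ℝ => Complex.I * ω * (t : ℂ)) (Complex.I * ω * 1) t :=
    (Complex.ofRealCLM.hasDerivAt (x := t)).const_mul _
  exact h.cexp.congr_deriv (by ring)

theorem hasDerivAt_freeEvolution {K : Matrix (Fin n) (Fin n) ℝ} {freq : ι → ℝ}
    {e : ι → Fin n → ℂ}
    (he : ∀ l, (complexify K).mulVec (e l) = (Complex.I * (freq l : ℂ)) • e l) (c : ι → ℂ)
    (t : ℝ) :
    HasDerivAt (freeEvolution freq e c) ((complexify K).mulVec (freeEvolution freq e c t)) t := by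
  have h := HasDerivAt.fun_sum (u := Finset.univ) fun l _ =>
    (((hasDerivAt_exp_freq (freq l) t).const_mul (c l)).smul_const (e l))
  refine h.congr_deriv ?_
  rw [freeEvolution, Matrix.mulVec_sum]
  refine Finset.sum_congr rfl fun l _ => ?_
  rw [Matrix.mulVec_smul, he, smul_smul]
  congr 1; ring

/-- The free evolution of a real vector is real. -/
theorem star_freeEvolution {K : Matrix (Fin n) (Fin n) ℝ} {freq : ι → ℝ} {e : ι → Fin n → ℂ}
    (he : ∀ l, (complexify K).mulVec (e l) = (Complex.I * (freq l : ℂ)) • e l) {c : ι → ℂ}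
    {b : Fin n → ℝ} (hb : (fun i => (b i : ℂ)) = ∑ l, c l • e l) (t : ℝ) :
    star (freeEvolution freq e c t) = freeEvolution freq e c t := by
  set L : (Fin n → ℂ) →L[ℂ] (Fin n → ℂ) := LinearMap.toContinuousLinearMap (complexify K).mulVecLin
    with hL
  have hL' : ∀ v, L v = (complexify K).mulVec v := fun v => by simp [hL]
  have h0 : freeEvolution freq e c 0 = fun i => (b i : ℂ) := by
    rw [hb]; simp [freeEvolution]
  -- The eigensystem need not be closed under conjugation. Instead, the evolution and its conjugate
  -- solve the same real linear equation with the same real initial value.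
  have key : (fun t => star (freeEvolution freq e c t)) = freeEvolution freq e c := by
    refine ODE_solution_unique_univ (v := fun _ => L) (s := fun _ => Set.univ) (t₀ := 0)
      (K := ‖L‖₊) (fun _ => L.lipschitz.lipschitzOnWith) (fun t => ⟨?_, trivial⟩)
      (fun t => ⟨?_, trivial⟩) ?_
    · rw [hL', ← star_complexify_mulVec]
      exact (hasDerivAt_freeEvolution he c t).star
    · rw [hL']
      exact hasDerivAt_freeEvolution he c t
    · simp only [h0]
      ext i; simp
  exact congrFun key t

/-- The covector `g` enters twice: the force contributes the conjugate of `∑ e l μ * g μ` and the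
read-out contributes the number itself, whence the squared modulus. -/
theorem dotProduct_freeEvolution (freq : ι → ℝ) (e : ι → Fin n → ℂ) (g : Fin n → ℝ) (t : ℝ) :
    ∑ μ, (g μ : ℂ) * freeEvolution freq e
      (fun l => Complex.I * (Real.sign (freq l) : ℂ) * star (∑ μ, e l μ * (g μ : ℂ))) t μ =
    responseFunction freq
      (fun l => Real.sign (freq l) * ‖∑ μ, e l μ * (g μ : ℂ)‖ ^ 2) t := by
  simp only [freeEvolution, responseFunction, Finset.sum_apply, Pi.smul_apply, smul_eq_mul,
    Finset.mul_sum]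
  rw [Finset.sum_comm]
  refine Finset.sum_congr rfl fun l _ => ?_
  set p := ∑ μ, e l μ * (g μ : ℂ) with hp
  have h1 : (((Real.sign (freq l) * ‖p‖ ^ 2 : ℝ)) : ℂ) =
      (Real.sign (freq l) : ℂ) * (star p * p) := by
    rw [Complex.star_def, mul_comm (starRingEnd ℂ p), Complex.mul_conj, Complex.normSq_eq_norm_sq]
    push_cast; ring
  rw [h1]
  calc _ = Complex.I * (Real.sign (freq l) : ℂ) * star p *
        Complex.exp (Complex.I * freq l * t) * p := by
        rw [hp, Finset.mul_sum]
        exact Finset.sum_congr rfl fun μ _ => by ring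
    _ = _ := by ring

/-- The solution of the linearized equation `u' = K u + φ b` given by Duhamel's formula. -/
theorem exists_linearized_solution {K : Matrix (Fin n) (Fin n) ℝ} {freq : ι → ℝ}
    {e : ι → Fin n → ℂ}
    (he : ∀ l, (complexify K).mulVec (e l) = (Complex.I * (freq l : ℂ)) • e l) {c : ι → ℂ}
    {b : Fin n → ℝ} (hb : (fun i => (b i : ℂ)) = ∑ l, c l • e l) {φ : ℝ → ℝ} (hφ : Continuous φ)
    {a : ℝ} (ha : ∀ t ≤ a, φ t = 0) :
    ∃ u : ℝ → Fin n → ℝ, (∀ t ≤ a, u t = 0) ∧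
      (∀ t, HasDerivAt u (K.mulVec (u t) + φ t • b) t) ∧
      ∀ t i, (u t i : ℂ) = ∫ s in a..t, (φ s : ℂ) * freeEvolution freq e c (t - s) i := by
  -- Splitting `exp(i ω (t - s))` into a product leaves `t` only in the upper limit, so the
  -- fundamental theorem of calculus gives the derivative.
  set J : ι → ℝ → ℂ := fun l t => ∫ s in a..t, Complex.exp (Complex.I * freq l * (-s : ℝ)) * φ s
    with hJ
  have hJd : ∀ l t, HasDerivAt (J l) (Complex.exp (Complex.I * freq l * (-t : ℝ)) * φ t) t := by
    intro l t
    have hc : Continuous fun s : ℝ => Complex.exp (Complex.I * freq l * (-s : ℝ)) * (φ s : ℂ) := by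
      fun_prop
    exact intervalIntegral.integral_hasDerivAt_right (hc.intervalIntegrable _ _)
      (hc.stronglyMeasurableAtFilter _ _) hc.continuousAt
  set z : ℝ → Fin n → ℂ :=
    fun t => ∑ l, (c l * Complex.exp (Complex.I * freq l * t) * J l t) • e l with hz
  have hzd : ∀ t,
      HasDerivAt z ((complexify K).mulVec (z t) + (φ t : ℂ) • fun i => (b i : ℂ)) t := by
    intro t
    have h := HasDerivAt.fun_sum (u := Finset.univ) fun l _ =>
      ((((hasDerivAt_exp_freq (freq l) t).const_mul (c l)).mul (hJd l t)).smul_const (e l))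
    refine h.congr_deriv ?_
    rw [hb, hz, Matrix.mulVec_sum, Finset.smul_sum, ← Finset.sum_add_distrib]
    refine Finset.sum_congr rfl fun l _ => ?_
    rw [Matrix.mulVec_smul, he, smul_smul, smul_smul, ← add_smul]
    congr 1
    have h1 : Complex.exp (Complex.I * freq l * t) *
        Complex.exp (Complex.I * freq l * (-t : ℝ)) = 1 := by
      rw [← Complex.exp_add]; simp
    linear_combination (c l * φ t) * h1
  have hzi : ∀ t i, z t i = ∫ s in a..t, (φ s : ℂ) * freeEvolution freq e c (t - s) i := by
    intro t i
    simp only [hz, freeEvolution, Finset.sum_apply, Pi.smul_apply, smul_eq_mul, Finset.mul_sum]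
    rw [intervalIntegral.integral_finsetSum fun l _ =>
      Continuous.intervalIntegrable (by fun_prop) _ _]
    refine Finset.sum_congr rfl fun l _ => ?_
    rw [hJ, ← intervalIntegral.integral_const_mul, ← intervalIntegral.integral_mul_const]
    refine intervalIntegral.integral_congr fun s _ => ?_
    have h1 : Complex.exp (Complex.I * freq l * (t - s : ℝ)) =
        Complex.exp (Complex.I * freq l * t) * Complex.exp (Complex.I * freq l * (-s : ℝ)) := by
      rw [← Complex.exp_add]; congr 1; push_cast; ring
    simp only [h1]; ring
  have hreal : ∀ t i, ((z t i).re : ℂ) = z t i := by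
    intro t i
    have : z t i = ((∫ s in a..t, φ s * (freeEvolution freq e c (t - s) i).re : ℝ) : ℂ) := by
      rw [hzi, ← intervalIntegral.integral_ofReal]
      refine intervalIntegral.integral_congr fun s _ => ?_
      have := congrFun (star_freeEvolution he hb (t - s)) i
      simp only [Pi.star_apply, Complex.star_def] at this
      simp only [Complex.ofReal_mul, Complex.conj_eq_iff_re.mp this]
    rw [this, Complex.ofReal_re]
  refine ⟨fun t i => (z t i).re, fun t ht => ?_, fun t => ?_, fun t i => ?_⟩
  · funext i
    change (z t i).re = 0
    rw [hzi, intervalIntegral.integral_symm, intervalIntegral.integral_congr (g := fun _ => 0)]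
    · simp
    · intro s hs
      rw [Set.uIcc_of_le ht] at hs
      simp [ha s hs.2]
  · rw [hasDerivAt_pi]
    intro i
    have h1 := (hasDerivAt_pi.mp (hzd t)) i
    have h2 := Complex.reCLM.hasFDerivAt.comp_hasDerivAt t h1
    refine h2.congr_deriv ?_
    have h3 : z t = fun i => (((z t i).re : ℝ) : ℂ) := funext fun i => (hreal t i).symm
    rw [h3, complexify_mulVec_ofReal]
    simp
  · rw [hreal, hzi]

end LinearizedResponse

/-! ### The retarded Green's function as a tempered distribution -/

section Green

open FourierTransform

theorem norm_exp_I_mul_mul (u s : ℝ) : ‖Complex.exp (Complex.I * u * s)‖ = 1 := by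
  rw [mul_assoc, mul_comm, ← Complex.ofReal_mul, Complex.norm_exp_ofReal_mul_I]

/-- The Fourier transform in the convention of `physFourier`, on Schwartz functions. -/
noncomputable def physFourierCLM : 𝓢(ℝ, ℂ) →L[ℂ] 𝓢(ℝ, ℂ) :=
  (SchwartzMap.compCLMOfContinuousLinearEquiv ℂ
    (ContinuousLinearEquiv.smulLeft (Units.mk0 (2 * Real.pi)⁻¹
      (inv_ne_zero Real.two_pi_pos.ne')) : ℝ ≃L[ℝ] ℝ)).comp
    (fourierInvCLM ℂ 𝓢(ℝ, ℂ))

theorem physFourier_eq_fourierInv (θ : 𝓢(ℝ, ℂ)) (t : ℝ) :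
    physFourier θ t = (𝓕⁻ θ : 𝓢(ℝ, ℂ)) (t / (2 * Real.pi)) := by
  rw [SchwartzMap.fourierInv_coe, Real.fourierInv_eq', physFourier]
  refine integral_congr_ae (Eventually.of_forall fun u => ?_)
  simp only [smul_eq_mul]
  congr 2
  have : 2 * Real.pi * inner ℝ u (t / (2 * Real.pi)) = u * t := by
    have := Real.pi_ne_zero
    simp only [RCLike.inner_apply, conj_trivial]
    field_simp
  rw [this]; push_cast; ring

theorem physFourierCLM_apply (θ : 𝓢(ℝ, ℂ)) (t : ℝ) : physFourierCLM θ t = physFourier θ t := by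
  rw [physFourier_eq_fourierInv, div_eq_inv_mul]
  rfl

theorem integrable_physFourier (θ : 𝓢(ℝ, ℂ)) : Integrable (physFourier θ) := by
  have := (physFourierCLM θ).integrable (μ := volume)
  simpa only [funext (physFourierCLM_apply θ)] using this

/-- Fourier inversion. -/
theorem integral_exp_mul_physFourier (θ : 𝓢(ℝ, ℂ)) (ω : ℝ) :
    ∫ t : ℝ, Complex.exp (-(Complex.I * ω * t)) * physFourier θ t = 2 * Real.pi * θ ω := by
  have h1 : 𝓕 (𝓕⁻ θ) = θ := FourierTransform.fourier_fourierInv_eq θ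
  have h2 : θ ω = ∫ v : ℝ, Complex.exp (-(Complex.I * ω * (2 * Real.pi * v : ℝ))) *
      (𝓕⁻ θ : 𝓢(ℝ, ℂ)) v := by
    conv_lhs => rw [← h1]
    rw [SchwartzMap.fourier_coe, Real.fourier_real_eq_integral_exp_smul]
    refine integral_congr_ae (Eventually.of_forall fun v => ?_)
    simp only [smul_eq_mul]
    congr 2
    push_cast; ring
  have h3 := Measure.integral_comp_div (fun v : ℝ =>
    Complex.exp (-(Complex.I * ω * (2 * Real.pi * v : ℝ))) * (𝓕⁻ θ : 𝓢(ℝ, ℂ)) v) (2 * Real.pi)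
  rw [← h2, abs_of_pos Real.two_pi_pos] at h3
  have h4 : ∀ t : ℝ, 2 * Real.pi * (t / (2 * Real.pi)) = t := fun t => by
    field_simp
  simp only [h4, ← physFourier_eq_fourierInv] at h3
  rw [h3]; simp

theorem star_physFourier {θ : 𝓢(ℝ, ℂ)} (hθ : ∀ w, (θ w).im = 0) (t : ℝ) :
    star (physFourier θ t) = physFourier θ (-t) := by
  rw [physFourier, physFourier, Complex.star_def, ← integral_conj]
  refine integral_congr_ae (Eventually.of_forall fun u => ?_)
  simp [Complex.conj_eq_iff_im.mpr (hθ u), ← Complex.exp_conj]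

variable {χ : ℝ → ℂ} {B : ℝ}

theorem measurable_causal (hχ : Continuous χ) : Measurable ((Set.Ici 0).indicator χ) :=
  hχ.measurable.indicator measurableSet_Ici

theorem norm_causal_le (hB : ∀ t, ‖χ t‖ ≤ B) (t : ℝ) : ‖(Set.Ici 0).indicator χ t‖ ≤ B :=
  (norm_indicator_le_norm_self χ t).trans (hB t)

theorem memLp_causal (hχ : Continuous χ) (hB : ∀ t, ‖χ t‖ ≤ B) :
    MemLp ((Set.Ici 0).indicator χ) ⊤ (volume : Measure ℝ) :=
  memLp_top_of_bound (measurable_causal hχ).aestronglyMeasurable B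
    (Eventually.of_forall (norm_causal_le hB))

/-- The Fourier transform of the causal function `χ(t) 1_{t ≥ 0}`. -/
noncomputable def greenFunction (hχ : Continuous χ) (hB : ∀ t, ‖χ t‖ ≤ B) : 𝓢'(ℝ, ℂ) :=
  PointwiseConvergenceCLM.precomp ℂ physFourierCLM
    (Lp.toTemperedDistribution ((memLp_causal hχ hB).toLp _))

theorem greenFunction_apply (hχ : Continuous χ) (hB : ∀ t, ‖χ t‖ ≤ B) (η : 𝓢(ℝ, ℂ)) :
    greenFunction hχ hB η = ∫ t, (Set.Ici 0).indicator χ t * physFourier η t := by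
  have : greenFunction hχ hB η =
    Lp.toTemperedDistribution ((memLp_causal hχ hB).toLp _) (physFourierCLM η) := rfl
  rw [this, Lp.toTemperedDistribution_apply]
  refine integral_congr_ae ?_
  filter_upwards [(memLp_causal hχ hB).coeFn_toLp] with t ht
  rw [ht, physFourierCLM_apply, smul_eq_mul, mul_comm]

/-- Vanishing of `φ` up to `a` supplies the lower limit and causality the upper one; for `t < a`
both sides are zero. -/
theorem causal_convolution_eq {φ : ℝ → ℝ} {a : ℝ} (ha : ∀ t ≤ a, φ t = 0) (t : ℝ) :
    ∫ s in a..t, (φ s : ℂ) * χ (t - s) = ∫ s, (φ s : ℂ) * (Set.Ici 0).indicator χ (t - s) := by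
  rcases le_or_gt a t with h | h
  · rw [intervalIntegral.integral_of_le h, ← integral_indicator measurableSet_Ioc]
    refine integral_congr_ae (Eventually.of_forall fun s => ?_)
    by_cases h1 : s ≤ a
    · simp [ha s h1, Set.indicator]
    · by_cases h2 : s ≤ t
      · simp [Set.indicator, h2, not_le.mp h1]
      · simp [Set.indicator, h2]
  · rw [intervalIntegral.integral_symm, intervalIntegral.integral_congr (g := fun _ => 0)]
    · rw [integral_congr_ae (g := fun _ => (0 : ℂ))]
      · simp
      · refine Eventually.of_forall fun s => ?_
        by_cases h1 : s ≤ t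
        · simp [ha s (h1.trans h.le)]
        · simp [Set.indicator, h1]
    · intro s hs
      rw [Set.uIcc_of_le h.le] at hs
      simp [ha s hs.2]

/-- By Fubini, multiplication by the transform of `φ` in frequency is correlation with `φ` in time.
-/
theorem physFourier_mul_eq {φ : ℝ → ℝ} (hφ : Continuous φ) (hφc : HasCompactSupport φ)
    {θ η : 𝓢(ℝ, ℂ)} (hη : ∀ w, η w = physFourier (fun t => (φ t : ℂ)) w * θ w) (τ : ℝ) :
    physFourier η τ = ∫ s, (φ s : ℂ) * physFourier θ (s + τ) := by
  have hφi : Integrable (fun s => (φ s : ℂ)) := (hφ.integrable_of_hasCompactSupport hφc).ofReal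
  have hint : Integrable (fun z : ℝ × ℝ => Complex.exp (Complex.I * z.1 * (z.2 + τ : ℝ)) *
      (θ z.1 * (φ z.2 : ℂ))) (volume.prod volume) := by
    refine ((θ.integrable (μ := volume)).mul_prod hφi).bdd_mul (c := 1) ?_ ?_
    · exact Continuous.aestronglyMeasurable (by fun_prop)
    · exact Eventually.of_forall fun z => (norm_exp_I_mul_mul _ _).le
  have h1 : physFourier η τ = ∫ u : ℝ, ∫ s : ℝ, Complex.exp (Complex.I * u * (s + τ : ℝ)) *
      (θ u * (φ s : ℂ)) := by
    rw [physFourier]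
    refine integral_congr_ae (Eventually.of_forall fun u => ?_)
    simp only [hη]
    rw [physFourier, ← integral_mul_const, ← integral_const_mul]
    refine integral_congr_ae (Eventually.of_forall fun s => ?_)
    have : Complex.exp (Complex.I * u * (s + τ : ℝ)) =
        Complex.exp (Complex.I * u * τ) * Complex.exp (Complex.I * s * u) := by
      rw [← Complex.exp_add]; congr 1; push_cast; ring
    simp only [this]; ring
  rw [h1, integral_integral_swap hint]
  refine integral_congr_ae (Eventually.of_forall fun s => ?_)
  simp only
  rw [physFourier, ← integral_const_mul]
  refine integral_congr_ae (Eventually.of_forall fun u => ?_)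
  simp only; ring

/-- Causal convolutions correspond to products with the Green's function. -/
theorem integral_causal_convolution (hχ : Continuous χ) (hB : ∀ t, ‖χ t‖ ≤ B) {φ : ℝ → ℝ}
    (hφ : Continuous φ) (hφc : HasCompactSupport φ) {θ η : 𝓢(ℝ, ℂ)}
    (hη : ∀ w, η w = physFourier (fun t => (φ t : ℂ)) w * θ w) :
    Integrable (fun t => (∫ s, (φ s : ℂ) * (Set.Ici 0).indicator χ (t - s)) * physFourier θ t) ∧
    ∫ t, (∫ s, (φ s : ℂ) * (Set.Ici 0).indicator χ (t - s)) * physFourier θ t =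
      greenFunction hχ hB η := by
  have hφi : Integrable (fun s => (φ s : ℂ)) := (hφ.integrable_of_hasCompactSupport hφc).ofReal
  set F := physFourier θ with hF
  set h : ℝ × ℝ → ℂ :=
    fun z => (Set.Ici 0).indicator χ (z.2 - z.1) * ((φ z.1 : ℂ) * F z.2) with hh
  have hint : Integrable h (volume.prod volume) := by
    refine (hφi.mul_prod (integrable_physFourier θ)).bdd_mul (c := B) ?_ ?_
    · exact ((measurable_causal hχ).comp (measurable_snd.sub measurable_fst)).aestronglyMeasurable
    · exact Eventually.of_forall fun z => norm_causal_le hB _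
  -- The substitution `t = s + τ` isolates the causal response at delay `τ`; the shear preserves the
  -- product measure, so Fubini applies after it too.
  have hshear : Integrable (fun z : ℝ × ℝ => h (z.1, z.1 + z.2)) (volume.prod volume) :=
    (measurePreserving_prod_add volume volume).integrable_comp_of_integrable hint
  have e1 : ∀ t, (∫ s, (φ s : ℂ) * (Set.Ici 0).indicator χ (t - s)) * F t = ∫ s, h (s, t) := by
    intro t
    rw [← integral_mul_const]
    refine integral_congr_ae (Eventually.of_forall fun s => ?_)
    simp only [hh]; ring
  simp only [e1]
  refine ⟨hint.integral_prod_right, ?_⟩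
  have s1 : ∫ t, ∫ s, h (s, t) = ∫ s, ∫ t, h (s, t) :=
    (integral_integral_swap (f := fun s t => h (s, t)) hint).symm
  have s2 : ∫ s, ∫ t, h (s, t) = ∫ s, ∫ τ, h (s, s + τ) :=
    integral_congr_ae (Eventually.of_forall fun s =>
      (integral_add_left_eq_self (fun t => h (s, t)) s).symm)
  have s3 : ∫ s, ∫ τ, h (s, s + τ) = ∫ τ, ∫ s, h (s, s + τ) :=
    integral_integral_swap (f := fun s τ => h (s, s + τ)) hshear
  rw [s1, s2, s3, greenFunction_apply]
  refine integral_congr_ae (Eventually.of_forall fun τ => ?_)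
  simp only
  rw [physFourier_mul_eq hφ hφc hη, ← integral_const_mul]
  refine integral_congr_ae (Eventually.of_forall fun s => ?_)
  simp only [hh, add_sub_cancel_left]
  rfl

/-- The imaginary part of the Green's function of a real response function. -/
theorem im_greenFunction {ι : Type} [Fintype ι] {freq κ : ι → ℝ}
    (hreal : ∀ t, star (responseFunction freq κ t) = responseFunction freq κ t)
    {θ : 𝓢(ℝ, ℂ)} (hθ : ∀ w, (θ w).im = 0) :
    (greenFunction (continuous_responseFunction freq κ) (norm_responseFunction_le freq κ) θ).im =
      -(Real.pi * ∑ l, κ l * (θ (freq l)).re) := by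
  set χ := responseFunction freq κ with hχ
  set F := physFourier θ with hF
  set G := greenFunction (continuous_responseFunction freq κ) (norm_responseFunction_le freq κ) θ
    with hG
  have hχi : Integrable fun t => χ t * F t :=
    (integrable_physFourier θ).bdd_mul (continuous_responseFunction freq κ).aestronglyMeasurable
      (Eventually.of_forall (norm_responseFunction_le freq κ))
  -- Reality allows every exponential to be conjugated, so that Fourier inversion evaluates `θ` at
  -- `freq l` rather than at `-freq l`. Comparison with the original form also shows that `χ` is
  -- odd.
  have hconj : ∀ t, χ t =
      ∑ l, (-(Complex.I * (κ l : ℂ))) * Complex.exp (-(Complex.I * freq l * t)) := by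
    intro t
    rw [← hreal t, hχ, responseFunction, star_sum]
    refine Finset.sum_congr rfl fun l _ => ?_
    simp [← Complex.exp_conj, neg_mul]
  have hodd : ∀ t, χ (-t) = -χ t := by
    intro t
    rw [hconj t, hχ, responseFunction, ← Finset.sum_neg_distrib]
    refine Finset.sum_congr rfl fun l _ => ?_
    simp
  have h1 : G = ∫ t in Set.Ioi 0, χ t * F t := by
    rw [hG, greenFunction_apply, ← integral_Ici_eq_integral_Ioi,
      ← integral_indicator measurableSet_Ici]
    refine integral_congr_ae (Eventually.of_forall fun t => ?_)
    simp only [Set.indicator_mul_left]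
    rfl
  -- By reality and oddness of `χ`, the conjugate supplies the missing half line with the opposite
  -- sign. Thus `G - star G` is an integral over the whole line and no principal values occur.
  have h2 : star G = -∫ t in Set.Iic 0, χ t * F t := by
    have : ∫ t in Set.Iic 0, χ t * F t = ∫ t in Set.Ioi 0, χ (-t) * F (-t) := by
      have := integral_comp_neg_Ioi (0 : ℝ) (fun t => χ t * F t)
      rw [neg_zero] at this
      exact this.symm
    rw [this, h1, Complex.star_def, ← integral_conj, ← integral_neg]
    refine integral_congr_ae (Eventually.of_forall fun t => ?_)
    simp only
    rw [hodd, map_mul, ← Complex.star_def, hreal, hF, star_physFourier hθ]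
    ring
  have h3 : G - star G = ∑ l, (-(Complex.I * (κ l : ℂ))) * (2 * Real.pi * θ (freq l)) := by
    have h4 : G - star G = ∫ t, χ t * F t := by
      rw [h2, h1, sub_neg_eq_add, add_comm]
      have := intervalIntegral.integral_Iic_add_Ioi (b := (0 : ℝ)) hχi.integrableOn hχi.integrableOn
      rw [this]
    have h5 : ∀ l, Integrable fun t : ℝ => Complex.exp (-(Complex.I * freq l * t)) * F t := by
      intro l
      refine (integrable_physFourier θ).bdd_mul (c := 1)
        (Continuous.aestronglyMeasurable (by fun_prop)) (Eventually.of_forall fun t => ?_)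
      have : -(Complex.I * (freq l : ℂ) * t) = Complex.I * ((-freq l : ℝ) : ℂ) * t := by
        push_cast; ring
      rw [this, norm_exp_I_mul_mul]
    rw [h4]
    have h6 : ∀ t, χ t * F t = ∑ l, (-(Complex.I * (κ l : ℂ))) *
        (Complex.exp (-(Complex.I * freq l * t)) * F t) := by
      intro t
      rw [hconj, Finset.sum_mul]
      exact Finset.sum_congr rfl fun l _ => by ring
    simp only [h6]
    rw [integral_finsetSum _ fun l _ => (h5 l).const_mul _]
    refine Finset.sum_congr rfl fun l _ => ?_
    rw [integral_const_mul, hF, integral_exp_mul_physFourier]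
  have h7 := congrArg Complex.im h3
  rw [Complex.im_sum] at h7
  have h8 : (G - star G).im = 2 * G.im := by simp [two_mul]
  rw [h8] at h7
  have h9 : ∀ l, ((-(Complex.I * (κ l : ℂ))) * (2 * Real.pi * θ (freq l))).im =
      2 * -(Real.pi * (κ l * (θ (freq l)).re)) := by
    intro l
    simp
    ring
  simp only [h9, ← Finset.mul_sum, Finset.sum_neg_distrib] at h7
  linarith

end Green

/-! ### A probe whose Fourier transform has a tempered inverse -/

section Probe

/-- The probe `φ(t) = max(1 - |t|, 0) exp t`. -/
noncomputable def hatProbe (t : ℝ) : ℝ := max (1 - |t|) 0 * Real.exp t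

theorem continuous_hatProbe : Continuous hatProbe := by
  unfold hatProbe; fun_prop

theorem hatProbe_eq_zero {t : ℝ} (ht : 1 ≤ |t|) : hatProbe t = 0 := by
  rw [hatProbe, max_eq_right (by linarith), zero_mul]

theorem hasCompactSupport_hatProbe : HasCompactSupport hatProbe := by
  refine HasCompactSupport.intro (isCompact_Icc (a := (-1 : ℝ)) (b := 1)) fun t ht => ?_
  refine hatProbe_eq_zero ?_
  by_contra h
  exact ht (abs_le.mp (not_le.mp h).le)

theorem integral_linear_mul_exp {a : ℂ} (ha : a ≠ 0) (p q : ℂ) (x y : ℝ) :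
    ∫ s in x..y, (p + q * s) * Complex.exp (a * s) =
      ((p + q * y) / a - q / a ^ 2) * Complex.exp (a * y) -
        ((p + q * x) / a - q / a ^ 2) * Complex.exp (a * x) := by
  refine intervalIntegral.integral_eq_sub_of_hasDerivAt
    (f := fun s : ℝ => ((p + q * s) / a - q / a ^ 2) * Complex.exp (a * s)) (fun s _ => ?_)
    (Continuous.intervalIntegrable (by fun_prop) _ _)
  have h0 : HasDerivAt (fun s : ℝ => (s : ℂ)) 1 s := Complex.ofRealCLM.hasDerivAt
  have h1 : HasDerivAt (fun s : ℝ => (p + q * s) / a - q / a ^ 2) (q * 1 / a) s :=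
    (((h0.const_mul q).const_add p).div_const a).sub_const _
  have h2 : HasDerivAt (fun s : ℝ => Complex.exp (a * s)) (Complex.exp (a * s) * (a * 1)) s :=
    (h0.const_mul a).cexp
  refine (h1.mul h2).congr_deriv ?_
  field_simp
  ring

/-- On each half of the support the integrand is affine times `exp(a u)` with `a = 1 + i w`. The
result is the square of `(exp(a/2) - exp(-a/2)) / a`. -/
theorem physFourier_hatProbe (w : ℝ) :
    physFourier (fun t => (hatProbe t : ℂ)) w =
      (Complex.exp (1 + Complex.I * w) + Complex.exp (-(1 + Complex.I * w)) - 2) /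
        (1 + Complex.I * w) ^ 2 := by
  set a : ℂ := 1 + Complex.I * w with ha
  have ha0 : a ≠ 0 := by
    intro h
    have := congrArg Complex.re h
    simp [ha] at this
  have hc : Continuous fun u : ℝ => Complex.exp (Complex.I * u * w) * (hatProbe u : ℂ) := by
    have := continuous_hatProbe
    fun_prop
  have h0 : physFourier (fun t => (hatProbe t : ℂ)) w =
      ∫ u in (-1 : ℝ)..1, Complex.exp (Complex.I * u * w) * (hatProbe u : ℂ) := by
    rw [physFourier, intervalIntegral.integral_of_le (by norm_num),
      setIntegral_eq_integral_of_forall_compl_eq_zero]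
    intro u hu
    rw [hatProbe_eq_zero]
    · simp
    · by_contra h
      have h' := abs_lt.mp (not_le.mp h)
      exact hu ⟨h'.1, h'.2.le⟩
  have hexp : ∀ u : ℝ, Complex.exp (a * u) =
      Complex.exp (Complex.I * u * w) * (Real.exp u : ℂ) := by
    intro u
    rw [Complex.ofReal_exp, ← Complex.exp_add]; congr 1; rw [ha]; ring
  have h1 : ∫ u in (-1 : ℝ)..0, Complex.exp (Complex.I * u * w) * (hatProbe u : ℂ) =
      ∫ u in (-1 : ℝ)..0, (1 + 1 * (u : ℂ)) * Complex.exp (a * u) := by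
    refine intervalIntegral.integral_congr fun u hu => ?_
    rw [Set.uIcc_of_le (by norm_num)] at hu
    simp only [hexp, hatProbe]
    rw [abs_of_nonpos hu.2, max_eq_left (by linarith [hu.1])]
    push_cast; ring
  have h2 : ∫ u in (0 : ℝ)..1, Complex.exp (Complex.I * u * w) * (hatProbe u : ℂ) =
      ∫ u in (0 : ℝ)..1, (1 + (-1) * (u : ℂ)) * Complex.exp (a * u) := by
    refine intervalIntegral.integral_congr fun u hu => ?_
    rw [Set.uIcc_of_le (by norm_num)] at hu
    simp only [hexp, hatProbe]
    rw [abs_of_nonneg hu.1, max_eq_left (by linarith [hu.2])]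
    push_cast; ring
  rw [h0, ← intervalIntegral.integral_add_adjacent_intervals (b := 0)
    (hc.intervalIntegrable _ _) (hc.intervalIntegrable _ _), h1, h2,
    integral_linear_mul_exp ha0, integral_linear_mul_exp ha0]
  simp only [Complex.ofReal_zero, Complex.ofReal_neg, Complex.ofReal_one, mul_zero, mul_one,
    mul_neg, Complex.exp_zero]
  field_simp
  ring

/-- A zero would force `exp a = 1`, but `|exp a| = exp 1`. This is why the probe carries the factor
`exp t`: the transform of the plain hat function vanishes at the non-zero multiples of `2π`. -/
theorem exp_add_exp_neg_sub_two_ne_zero (w : ℝ) :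
    Complex.exp (1 + Complex.I * w) + Complex.exp (-(1 + Complex.I * w)) - 2 ≠ 0 := by
  set a : ℂ := 1 + Complex.I * w with ha
  intro h
  have h1 : Complex.exp a * Complex.exp (-a) = 1 := by rw [← Complex.exp_add]; simp
  have h2 : (Complex.exp a - 1) ^ 2 = 0 := by
    linear_combination Complex.exp a * h - h1
  have h3 : Complex.exp a = 1 := sub_eq_zero.mp (pow_eq_zero_iff two_ne_zero |>.mp h2)
  have h4 := congrArg norm h3
  rw [Complex.norm_exp] at h4
  simp [ha] at h4

/-- All derivatives are continuous and periodic, hence bounded. -/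
theorem hasTemperateGrowth_of_periodic {f : ℝ → ℂ} (hf : ContDiff ℝ ((⊤ : ℕ∞) : WithTop ℕ∞) f)
    {c : ℝ} (hc : c ≠ 0) (hp : Function.Periodic f c) : f.HasTemperateGrowth := by
  refine ⟨hf, fun m => ?_⟩
  have hper : Function.Periodic (iteratedFDeriv ℝ m f) c := by
    intro x
    rw [← iteratedFDeriv_comp_add_right]
    congr 1
    exact funext hp
  have hcont : Continuous (iteratedFDeriv ℝ m f) :=
    hf.continuous_iteratedFDeriv (by exact_mod_cast le_top)
  obtain ⟨C, hC⟩ := (hper.isBounded_of_continuous hc hcont).exists_norm_le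
  exact ⟨0, C, fun x => by simpa using hC _ ⟨x, rfl⟩⟩

/-- The inverse of the Fourier transform of `hatProbe`. -/
noncomputable def inverseProbe (w : ℝ) : ℂ :=
  (1 + Complex.I * w) ^ 2 *
    (Complex.exp (1 + Complex.I * w) + Complex.exp (-(1 + Complex.I * w)) - 2)⁻¹

theorem hasTemperateGrowth_inverseProbe : inverseProbe.HasTemperateGrowth := by
  have h1 : Function.HasTemperateGrowth fun w : ℝ => (1 + Complex.I * (w : ℂ)) := by
    have := Function.Complex.hasTemperateGrowth_ofReal
    fun_prop
  have h2 : Function.HasTemperateGrowth fun w : ℝ =>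
      (Complex.exp (1 + Complex.I * w) + Complex.exp (-(1 + Complex.I * w)) - 2)⁻¹ := by
    refine hasTemperateGrowth_of_periodic (c := 2 * Real.pi) ?_ Real.two_pi_pos.ne' ?_
    · refine ContDiff.inv ?_ exp_add_exp_neg_sub_two_ne_zero
      have h0 : ContDiff ℝ ((⊤ : ℕ∞) : WithTop ℕ∞) fun w : ℝ => (w : ℂ) :=
        Complex.ofRealCLM.contDiff
      have h3 : ContDiff ℝ ((⊤ : ℕ∞) : WithTop ℕ∞) fun w : ℝ => 1 + Complex.I * (w : ℂ) :=
        contDiff_const.add (contDiff_const.mul h0)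
      exact (h3.cexp.add h3.neg.cexp).sub contDiff_const
    · intro w
      have e1 : Complex.exp (1 + Complex.I * ((w + 2 * Real.pi : ℝ) : ℂ)) =
          Complex.exp (1 + Complex.I * w) := by
        rw [← Complex.exp_periodic (1 + Complex.I * w)]; congr 1; push_cast; ring
      have e2 : Complex.exp (-(1 + Complex.I * ((w + 2 * Real.pi : ℝ) : ℂ))) =
          Complex.exp (-(1 + Complex.I * w)) := by
        rw [Complex.exp_neg, e1, ← Complex.exp_neg]
      simp only [e1, e2]
  have := (h1.pow 2).mul h2
  exact this

/-- Division by the transform of the probe preserves Schwartz functions, so the response to this one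
probe determines the Green's function on every test function. -/
theorem exists_eq_physFourier_hatProbe_mul (η : 𝓢(ℝ, ℂ)) :
    ∃ θ : 𝓢(ℝ, ℂ), ∀ w, η w = physFourier (fun t => (hatProbe t : ℂ)) w * θ w := by
  refine ⟨SchwartzMap.smulLeftCLM ℂ inverseProbe η, fun w => ?_⟩
  rw [SchwartzMap.smulLeftCLM_apply_apply hasTemperateGrowth_inverseProbe, physFourier_hatProbe,
    smul_eq_mul, inverseProbe]
  have h1 := exp_add_exp_neg_sub_two_ne_zero w
  have ha0 : (1 + Complex.I * w : ℂ) ≠ 0 := by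
    intro h
    have := congrArg Complex.re h
    simp at this
  field_simp

end Probe

/-! ### Spectral distributions -/

section Spectral

theorem temperedDistribution_ext_real {A A' : 𝓢'(ℝ, ℂ)}
    (h : ∀ θ : 𝓢(ℝ, ℂ), (∀ w, (θ w).im = 0) → A θ = A' θ) : A = A' := by
  refine DFunLike.ext _ _ fun θ => ?_
  set θ₁ : 𝓢(ℝ, ℂ) := SchwartzMap.postcompCLM (𝕜 := ℝ) (Complex.ofRealCLM ∘L Complex.reCLM) θ
    with h1
  set θ₂ : 𝓢(ℝ, ℂ) := SchwartzMap.postcompCLM (𝕜 := ℝ) (Complex.ofRealCLM ∘L Complex.imCLM) θ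
    with h2
  have e1 : ∀ w, θ₁ w = ((θ w).re : ℂ) := fun w => by simp [h1]
  have e2 : ∀ w, θ₂ w = ((θ w).im : ℂ) := fun w => by simp [h2]
  have e : θ = θ₁ + Complex.I • θ₂ := by
    ext w
    simp only [add_apply, smul_apply, e1, e2, smul_eq_mul]
    rw [mul_comm, Complex.re_add_im]
  have k1 := h θ₁ fun w => by simp [e1]
  have k2 := h θ₂ fun w => by simp [e2]
  rw [e, map_add, map_add, map_smul, map_smul, k1, k2]

variable {ι : Type} [Fintype ι]

/-- The distribution `∑ κ_ℓ δ(ω - ω_ℓ)`. -/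
noncomputable def diracSum (freq κ : ι → ℝ) : 𝓢'(ℝ, ℂ) :=
  ∑ l, (κ l : ℂ) • TemperedDistribution.delta (freq l)

theorem diracSum_apply (freq κ : ι → ℝ) (θ : 𝓢(ℝ, ℂ)) :
    diracSum freq κ θ = ∑ l, (κ l : ℂ) * θ (freq l) := by
  have : ∀ s : Finset ι, (∑ l ∈ s, (κ l : ℂ) • TemperedDistribution.delta (freq l) : 𝓢'(ℝ, ℂ)) θ =
      ∑ l ∈ s, (κ l : ℂ) * θ (freq l) := by
    classical
    intro s
    induction s using Finset.induction_on with
    | empty => simp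
    | insert a s ha ih =>
      rw [Finset.sum_insert ha, Finset.sum_insert ha, ← ih]
      rfl
  exact this _

/-- Only an inclusion, since weights at coinciding frequencies may cancel. It suffices: a support
point yields an index with non-zero weight, which makes the sign strict below. -/
theorem dsupport_diracSum_subset (freq κ : ι → ℝ) :
    Distribution.dsupport (fun θ : 𝓢(ℝ, ℂ) => diracSum freq κ θ) ⊆
      {w | ∃ l, freq l = w ∧ κ l ≠ 0} := by
  intro w hw
  by_contra hne
  have hfin : (Set.range fun l : {l // κ l ≠ 0} => freq l).Finite := Set.finite_range _
  refine (Distribution.notMem_dsupport_iff w).mpr ⟨_, ?_, hfin.isClosed.isOpen_compl, ?_⟩ hw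
  · intro θ hθ
    simp only [diracSum_apply]
    refine Finset.sum_eq_zero fun l _ => ?_
    by_cases hl : κ l = 0
    · simp [hl]
    · have : freq l ∉ tsupport θ := fun h => hθ h ⟨⟨l, hl⟩, rfl⟩
      rw [image_eq_zero_of_notMem_tsupport this, mul_zero]
  · rintro ⟨⟨l, hl⟩, h⟩
    exact hne ⟨l, h, hl⟩

/-- A sum of delta functions whose weights have the signs of the frequencies. -/
theorem signEqSignFrequency_diracSum {freq : ι → ℝ} (hfreq : ∀ l, freq l ≠ 0) {c : ι → ℝ}
    (hc : ∀ l, 0 ≤ c l) :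
    SignEqSignFrequency (diracSum freq fun l => Real.sign (freq l) * c l) := by
  set κ : ι → ℝ := fun l => Real.sign (freq l) * c l with hκ
  have hpos : ∀ l, 0 < freq l → κ l = c l := fun l hl => by simp [hκ, Real.sign_of_pos hl]
  have hneg : ∀ l, freq l < 0 → κ l = -c l := fun l hl => by simp [hκ, Real.sign_of_neg hl]
  have hsub := dsupport_diracSum_subset freq κ
  refine ⟨fun h0 => ?_, fun θ hθ => ?_⟩
  · obtain ⟨l, hl, -⟩ := hsub h0
    exact hfreq l hl
  have hval : diracSum freq κ θ = ((∑ l, κ l * (θ (freq l)).re : ℝ) : ℂ) := by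
    rw [diracSum_apply]
    push_cast
    refine Finset.sum_congr rfl fun l _ => ?_
    congr 1
    exact Complex.ext rfl (by simp [(hθ (freq l)).1])
  have hre : ∀ w, θ w ≠ 0 → 0 < (θ w).re := fun w hw =>
    lt_of_le_of_ne (hθ w).2 fun h => hw (Complex.ext h.symm (hθ w).1)
  refine ⟨fun hz => ⟨_, hval, ?_, ?_⟩, fun hz => ⟨_, hval, ?_, ?_⟩⟩
  · refine Finset.sum_nonneg fun l _ => ?_
    rcases (hfreq l).lt_or_gt with h | h
    · simp [hz _ h.le]
    · rw [hpos l h]; exact mul_nonneg (hc l) (hθ _).2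
  · rintro ⟨w, hw, hw0⟩
    obtain ⟨m, rfl, hm⟩ := hsub hw
    refine Finset.sum_pos' (fun l _ => ?_) ⟨m, Finset.mem_univ _, ?_⟩
    · rcases (hfreq l).lt_or_gt with h | h
      · simp [hz _ h.le]
      · rw [hpos l h]; exact mul_nonneg (hc l) (hθ _).2
    · have h : 0 < freq m := not_le.mp fun h => hw0 (hz _ h)
      rw [hpos m h] at hm ⊢
      exact mul_pos (lt_of_le_of_ne (hc m) hm.symm) (hre _ hw0)
  · refine Finset.sum_nonpos fun l _ => ?_
    rcases (hfreq l).lt_or_gt with h | h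
    · rw [hneg l h, neg_mul, neg_nonpos]; exact mul_nonneg (hc l) (hθ _).2
    · simp [hz _ h.le]
  · rintro ⟨w, hw, hw0⟩
    obtain ⟨m, rfl, hm⟩ := hsub hw
    rw [← neg_pos, ← Finset.sum_neg_distrib]
    refine Finset.sum_pos' (fun l _ => ?_) ⟨m, Finset.mem_univ _, ?_⟩
    · rcases (hfreq l).lt_or_gt with h | h
      · rw [hneg l h, neg_mul, neg_neg]; exact mul_nonneg (hc l) (hθ _).2
      · simp [hz _ h.le]
    · have h : freq m < 0 := not_le.mp fun h => hw0 (hz _ h)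
      rw [hneg m h] at hm ⊢
      rw [neg_mul, neg_neg]
      exact mul_pos (lt_of_le_of_ne (hc m) (neg_ne_zero.mp hm).symm) (hre _ hw0)

end Spectral

/-! ### Regularity of the geometric data -/

section Geometry

variable {𝓗 : Type*} [NormedAddCommGroup 𝓗] [InnerProductSpace ℂ 𝓗] {n : ℕ}
  {ψ : (Fin n → ℝ) → 𝓗} {x : Fin n → ℝ}

theorem contDiffAt_partialDeriv {F : Type*} [NormedAddCommGroup F] [NormedSpace ℝ F]
    {f : (Fin n → ℝ) → F} (hf : ContDiffAt ℝ 2 f x) (μ : Fin n) :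
    ContDiffAt ℝ 1 (partialDeriv f μ) x :=
  (hf.fderiv_right (m := 1) (by norm_num [one_add_one_eq_two])).clm_apply contDiffAt_const

theorem contDiffAt_tangentVector (hψ : ContDiffAt ℝ 2 ψ x) (h0 : ψ x ≠ 0) (μ : Fin n) :
    ContDiffAt ℝ 1 (fun y => tangentVector ψ y μ) x := by
  have h1 : ContDiffAt ℝ 1 ψ x := hψ.of_le (by norm_num)
  have h2 := contDiffAt_partialDeriv hψ μ
  have h3 : ContDiffAt ℝ 1 (fun y => inner ℂ (ψ y) (partialDeriv ψ μ y)) x := h1.inner ℂ h2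
  have h4 : ContDiffAt ℝ 1 (fun y => inner ℂ (ψ y) (ψ y)) x := h1.inner ℂ h1
  have h5 : inner ℂ (ψ x) (ψ x) ≠ 0 := inner_self_ne_zero.mpr h0
  unfold tangentVector
  simp only [div_eq_mul_inv]
  exact h2.sub ((h3.mul (h4.inv h5)).smul h1)

theorem contDiffAt_inner_tangentVector (hψ : ContDiffAt ℝ 2 ψ x) (h0 : ψ x ≠ 0) (μ ν : Fin n) :
    ContDiffAt ℝ 1 (fun y => inner ℂ (tangentVector ψ y μ) (tangentVector ψ y ν)) x :=
  (contDiffAt_tangentVector hψ h0 μ).inner ℂ (contDiffAt_tangentVector hψ h0 ν)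

theorem matrixContDiffAt_metric (hψ : ContDiffAt ℝ 2 ψ x) (h0 : ψ x ≠ 0) :
    MatrixContDiffAt 1 (metric ψ) x := fun μ ν => by
  have h1 : ContDiffAt ℝ 1 (fun y => ‖ψ y‖ ^ 2) x := (hψ.of_le (by norm_num)).norm_sq ℂ
  exact (contDiffAt_const.mul (Complex.reCLM.contDiff.contDiffAt.comp x
    (contDiffAt_inner_tangentVector hψ h0 μ ν))).div h1 (by positivity)

theorem matrixContDiffAt_symplecticForm (hψ : ContDiffAt ℝ 2 ψ x) (h0 : ψ x ≠ 0) :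
    MatrixContDiffAt 1 (symplecticForm ψ) x := fun μ ν => by
  have h1 : ContDiffAt ℝ 1 (fun y => ‖ψ y‖ ^ 2) x := (hψ.of_le (by norm_num)).norm_sq ℂ
  exact (contDiffAt_const.mul (Complex.imCLM.contDiff.contDiffAt.comp x
    (contDiffAt_inner_tangentVector hψ h0 μ ν))).div h1 (by positivity)

/-- The quadratic form at `v` is `2 ‖X‖² / ‖ψ‖²` for the tangent vector `X = ∑ v μ • V_μ`, which is
non-zero by independence over `ℝ`. -/
theorem posDef_metric (h0 : ψ x ≠ 0) (h : LinearIndependent ℝ (tangentVector ψ x)) :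
    (metric ψ x).PosDef := by
  have hp : 0 < ‖ψ x‖ ^ 2 := by positivity
  refine Matrix.PosDef.of_dotProduct_mulVec_pos ?_ fun v hv => ?_
  · ext μ ν
    simp only [metric, Matrix.conjTranspose_apply, Matrix.of_apply, star_trivial]
    rw [← inner_conj_symm (𝕜 := ℂ), Complex.conj_re]
  · set X := ∑ μ, v μ • tangentVector ψ x μ with hX
    have hX0 : X ≠ 0 := fun hX0 => hv (funext fun μ =>
      Fintype.linearIndependent_iff.mp h v hX0 μ)
    have key : star v ⬝ᵥ (metric ψ x).mulVec v = 2 * ‖X‖ ^ 2 / ‖ψ x‖ ^ 2 := by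
      have h1 : ‖X‖ ^ 2 = (inner ℂ X X).re := by
        rw [inner_self_eq_norm_sq_to_K]; norm_cast
      have h2 : inner ℂ X X = ∑ μ, ∑ ν, ((v μ * v ν : ℝ) : ℂ) *
          inner ℂ (tangentVector ψ x μ) (tangentVector ψ x ν) := by
        rw [hX, sum_inner]
        refine Finset.sum_congr rfl fun μ _ => ?_
        rw [inner_sum]
        refine Finset.sum_congr rfl fun ν _ => ?_
        rw [← Complex.coe_smul, ← Complex.coe_smul, inner_smul_left, inner_smul_right,
          Complex.conj_ofReal]
        push_cast; ring
      rw [h1, h2]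
      simp only [Complex.re_sum, Complex.re_ofReal_mul, dotProduct, Matrix.mulVec, metric,
        Matrix.of_apply, star_trivial, Finset.mul_sum, Finset.sum_div]
      refine Finset.sum_congr rfl fun μ _ => Finset.sum_congr rfl fun ν _ => ?_
      ring
    rw [key]
    positivity

theorem transpose_symplecticForm (ψ : (Fin n → ℝ) → 𝓗) (x : Fin n → ℝ) :
    (symplecticForm ψ x).transpose = -symplecticForm ψ x := by
  ext μ ν
  simp only [symplecticForm, Matrix.transpose_apply, Matrix.of_apply, Matrix.neg_apply]
  rw [← inner_conj_symm (𝕜 := ℂ), Complex.conj_im]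
  ring

theorem eventually_posDef_metric {U : Set (Fin n → ℝ)} (hU : U ∈ 𝓝 x)
    (hne : ∀ y ∈ U, ψ y ≠ 0) (himm : ∀ y ∈ U, LinearIndependent ℝ (tangentVector ψ y)) :
    ∀ᶠ y in 𝓝 x, (metric ψ y).PosDef :=
  mem_of_superset hU fun y hy => posDef_metric (hne y hy) (himm y hy)

theorem contDiffAt_lagrangianField {A : 𝓗 →ₗ.[ℂ] 𝓗}
    (hΩ : MatrixContDiffAt 1 (symplecticInverse ψ) x) (hA : ContDiffAt ℝ 2 (observable ψ A) x) :
    ContDiffAt ℝ 1 (lagrangianField ψ A) x := by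
  rw [contDiffAt_pi]
  intro i
  simp only [lagrangianField, Pi.neg_apply, Matrix.mulVec, dotProduct]
  exact (ContDiffAt.sum fun j _ => (hΩ i j).mul (contDiffAt_partialDeriv hA j)).neg

theorem fderiv_apply_eq_sum {f : (Fin n → ℝ) → ℝ} (v : Fin n → ℝ) :
    fderiv ℝ f x v = ∑ k, v k * partialDeriv f k x := by
  conv_lhs => rw [pi_eq_sum_univ' v]
  simp [partialDeriv, map_sum, Pi.single]

/-- At a critical point, the generator is the linearization of the Lagrangian evolution. -/
theorem hasFDerivAt_lagrangianField {H : 𝓗 →ₗ.[ℂ] 𝓗}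
    (hΩ : MatrixContDiffAt 1 (symplecticInverse ψ) x) (hE : ContDiffAt ℝ 2 (observable ψ H) x)
    (hcrit : gradient ψ H x = 0) (hsymm : (hessian (observable ψ H) x).IsSymm) :
    HasFDerivAt (lagrangianField ψ H)
      (LinearMap.toContinuousLinearMap (generator ψ H x).mulVecLin) x := by
  rw [hasFDerivAt_pi']
  intro i
  have h1 : ∀ j, HasFDerivAt (fun y => symplecticInverse ψ y i j * gradient ψ H y j)
      (symplecticInverse ψ x i j • fderiv ℝ (partialDeriv (observable ψ H) j) x) x := by
    intro j
    have d1 := ((hΩ i j).differentiableAt one_ne_zero).hasFDerivAt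
    have d2 := ((contDiffAt_partialDeriv hE j).differentiableAt one_ne_zero).hasFDerivAt
    -- The term with the derivative of `Ω` carries the gradient as a factor and drops out.
    have hj : partialDeriv (observable ψ H) j x = 0 := congrFun hcrit j
    have := d1.mul d2
    rwa [hj, zero_smul, add_zero] at this
  have h2 := (HasFDerivAt.fun_sum (u := Finset.univ) fun j _ => h1 j).neg
  refine h2.congr_fderiv ?_
  ext v
  simp only [neg_apply, sum_apply, smul_apply, smul_eq_mul, ContinuousLinearMap.comp_apply,
    ContinuousLinearMap.proj_apply, LinearMap.coe_toContinuousLinearMap', Matrix.mulVecLin_apply,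
    generator, Matrix.neg_mulVec, Pi.neg_apply, ← Matrix.mulVec_mulVec]
  congr 1
  simp only [Matrix.mulVec, dotProduct]
  refine Finset.sum_congr rfl fun j _ => ?_
  congr 1
  rw [fderiv_apply_eq_sum]
  refine Finset.sum_congr rfl fun k _ => ?_
  have : hessian (observable ψ H) x j k = hessian (observable ψ H) x k j :=
    (hsymm.apply j k).symm
  rw [this, mul_comm]
  rfl

theorem expectation_add_smul {H V : 𝓗 →ₗ.[ℂ] 𝓗} {φ : 𝓗} (hH : φ ∈ H.domain)
    (hV : φ ∈ V.domain) (c : ℝ) :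
    expectation (H + (c : ℂ) • V) φ = expectation H φ + c * expectation V φ := by
  have hdom : φ ∈ (H + (c : ℂ) • V).domain := ⟨hH, hV⟩
  have happ : (H + (c : ℂ) • V) ⟨φ, hdom⟩ = H ⟨φ, hH⟩ + (c : ℂ) • V ⟨φ, hV⟩ := rfl
  rw [expectation, expectation, expectation, dif_pos hdom, dif_pos hH, dif_pos hV, happ,
    inner_add_right, inner_smul_right, Complex.add_re, Complex.re_ofReal_mul]
  ring

/-- The projected evolution is linear in the Hamiltonian. -/
theorem lagrangianField_add_smul {H V : 𝓗 →ₗ.[ℂ] 𝓗} {U : Set (Fin n → ℝ)} (hU : U ∈ 𝓝 x)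
    (hdom : ∀ y ∈ U, ψ y ∈ H.domain ∧ ψ y ∈ V.domain)
    (hH : DifferentiableAt ℝ (observable ψ H) x) (hV : DifferentiableAt ℝ (observable ψ V) x)
    (c : ℝ) :
    lagrangianField ψ (H + (c : ℂ) • V) x =
      lagrangianField ψ H x + c • lagrangianField ψ V x := by
  -- Additivity holds where `ψ` lies in both domains, thus on a neighbourhood, which is enough for
  -- the gradients.
  have h1 : observable ψ (H + (c : ℂ) • V) =ᶠ[𝓝 x]
      fun y => observable ψ H y + c * observable ψ V y :=
    mem_of_superset hU fun y hy => expectation_add_smul (hdom y hy).1 (hdom y hy).2 c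
  have h2 : gradient ψ (H + (c : ℂ) • V) x = gradient ψ H x + c • gradient ψ V x := by
    funext μ
    simp only [gradient, partialDeriv, Pi.add_apply, Pi.smul_apply]
    rw [h1.fderiv_eq, fderiv_fun_add hH (hV.const_mul c), fderiv_const_mul hV]
    simp
  rw [lagrangianField, h2, Matrix.mulVec_add, Matrix.mulVec_smul, lagrangianField, lagrangianField]
  module

end Geometry

/-! ### Linear response -/

section Response

variable {𝓗 : Type*} [NormedAddCommGroup 𝓗] [InnerProductSpace ℂ 𝓗] {n : ℕ}
  {H V : 𝓗 →ₗ.[ℂ] 𝓗} {U : Set (Fin n → ℝ)} {ψ : (Fin n → ℝ) → 𝓗} {x₀ : Fin n → ℝ}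

/-- The existence clause provides an actual family of trajectories, so both responses are the
derivative of one function. -/
theorem IsLinearResponse.unique {φ δV δV' : ℝ → ℝ} (h : IsLinearResponse U ψ H V x₀ φ δV)
    (h' : IsLinearResponse U ψ H V x₀ φ δV') : δV = δV' := by
  funext t
  obtain ⟨x, hx⟩ := (h (t + 1)).1.choice
  exact ((h (t + 1)).2 x hx t (by linarith)).unique ((h' (t + 1)).2 x hx t (by linarith))

/-- The retarded Green's function is unique. -/
theorem IsRetardedGreenFunction.unique {G G' : 𝓢'(ℝ, ℂ)}
    (h : IsRetardedGreenFunction U ψ H V x₀ G) (h' : IsRetardedGreenFunction U ψ H V x₀ G') :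
    G = G' := by
  obtain ⟨δV, h1, h2⟩ := h hatProbe continuous_hatProbe hasCompactSupport_hatProbe
  obtain ⟨δV', h1', h2'⟩ := h' hatProbe continuous_hatProbe hasCompactSupport_hatProbe
  obtain rfl := h1.unique h1'
  refine DFunLike.ext _ _ fun η => ?_
  obtain ⟨θ, hθ⟩ := exists_eq_physFourier_hatProbe_mul η
  rw [← (h2 θ η hθ).2, ← (h2' θ η hθ).2]

/-- The assumptions on the variational family near the equilibrium `x₀`. -/
structure RegularEquilibrium (U : Set (Fin n → ℝ)) (ψ : (Fin n → ℝ) → 𝓗) (H V : 𝓗 →ₗ.[ℂ] 𝓗)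
    (x₀ : Fin n → ℝ) : Prop where
  isOpen : IsOpen U
  mem : x₀ ∈ U
  domain : ∀ x ∈ U, ψ x ∈ H.domain ∧ ψ x ∈ V.domain
  energy : ContDiffOn ℝ 2 (observable ψ H) U
  probe : ContDiffOn ℝ 2 (observable ψ V) U
  inverse : MatrixContDiffAt 1 (symplecticInverse ψ) x₀
  critical : gradient ψ H x₀ = 0
  linearized : LinearizedData (symplecticForm ψ x₀) (symplecticInverse ψ x₀)
    (hessian (observable ψ H) x₀)

theorem RegularEquilibrium.isPerturbedEvolution_iff (h : RegularEquilibrium U ψ H V x₀)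
    {φ : ℝ → ℝ} {ε T : ℝ} {x : ℝ → Fin n → ℝ} :
    IsPerturbedEvolution U ψ H V x₀ φ ε T x ↔
      IsForcedTrajectory U (lagrangianField ψ H) (lagrangianField ψ V) x₀ φ ε T x := by
  refine and_congr Iff.rfl (forall₂_congr fun t _ => and_congr_right fun hx => ?_)
  have hU := h.isOpen.mem_nhds hx
  rw [lagrangianField_add_smul hU h.domain
    ((h.energy.contDiffAt hU).differentiableAt two_ne_zero)
    ((h.probe.contDiffAt hU).differentiableAt two_ne_zero)]

variable {ι : Type} [Fintype ι] [DecidableEq ι] {freq : ι → ℝ} {e : ι → Fin n → ℂ}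

/-- The spectral weights `sgn(ω_ℓ) |ℰ_ℓ^μ ∂_μ V|²`. -/
noncomputable def spectralWeight (freq : ι → ℝ) (e : ι → Fin n → ℂ) (g : Fin n → ℝ) (l : ι) : ℝ :=
  Real.sign (freq l) * ‖∑ μ, e l μ * (g μ : ℂ)‖ ^ 2

theorem RegularEquilibrium.star_responseFunction (h : RegularEquilibrium U ψ H V x₀)
    (he : IsNormalizedEigensystem (symplecticForm ψ x₀) (generator ψ H x₀) freq e) (t : ℝ) :
    star (responseFunction freq (spectralWeight freq e (gradient ψ V x₀)) t) =
      responseFunction freq (spectralWeight freq e (gradient ψ V x₀)) t := by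
  have hb := h.linearized.force_eq_sum he (gradient ψ V x₀)
  have hf := star_freeEvolution he.eigen hb t
  have hd := dotProduct_freeEvolution freq e (gradient ψ V x₀) t
  change _ = responseFunction freq (spectralWeight freq e (gradient ψ V x₀)) t at hd
  rw [← hd, star_sum]
  refine Finset.sum_congr rfl fun μ _ => ?_
  have := congrFun hf μ
  rw [Pi.star_apply] at this
  rw [star_mul', this]
  simp

/-- The linear response is the causal convolution with the response function. -/
theorem RegularEquilibrium.exists_linearResponse (h : RegularEquilibrium U ψ H V x₀)
    (he : IsNormalizedEigensystem (symplecticForm ψ x₀) (generator ψ H x₀) freq e)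
    {φ : ℝ → ℝ} (hφ : Continuous φ) (hφc : HasCompactSupport φ) :
    ∃ δV : ℝ → ℝ, IsLinearResponse U ψ H V x₀ φ δV ∧ ∀ t, (δV t : ℂ) =
      ∫ s, (φ s : ℂ) * (Set.Ici 0).indicator
        (responseFunction freq (spectralWeight freq e (gradient ψ V x₀))) (t - s) := by
  have hU := h.isOpen.mem_nhds h.mem
  obtain ⟨Φ, hΦ⟩ := hφ.bounded_above_of_compact_support hφc
  obtain ⟨a, ha⟩ : ∃ a, ∀ t ≤ a, φ t = 0 := by
    obtain ⟨a, ha⟩ := hφc.isCompact.bddBelow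
    refine ⟨a - 1, fun t ht => image_eq_zero_of_notMem_tsupport fun hmem => ?_⟩
    have := ha hmem
    linarith
  have hX := contDiffAt_lagrangianField h.inverse (h.energy.contDiffAt hU)
  have hY := contDiffAt_lagrangianField h.inverse (h.probe.contDiffAt hU)
  have hX0 : lagrangianField ψ H x₀ = 0 := by
    rw [lagrangianField, h.critical, Matrix.mulVec_zero, neg_zero]
  have hsymm : (hessian (observable ψ H) x₀).IsSymm := by
    have := h.linearized.posDef.isHermitian.eq
    rwa [Matrix.conjTranspose_eq_transpose_of_trivial] at this
  have hX' := hasFDerivAt_lagrangianField h.inverse (h.energy.contDiffAt hU) h.critical hsymm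
  have hb := h.linearized.force_eq_sum he (gradient ψ V x₀)
  obtain ⟨u, hu0, hu, hui⟩ := exists_linearized_solution he.eigen hb hφ ha
  have hVd : HasFDerivAt (observable ψ V) (fderiv ℝ (observable ψ V) x₀) x₀ :=
    ((h.probe.contDiffAt hU).differentiableAt two_ne_zero).hasFDerivAt
  -- By the chain rule the response is the differential of `V` applied to the solution `u` of the
  -- linearized equation.
  refine ⟨fun t => fderiv ℝ (observable ψ V) x₀ (u t), fun T => ⟨?_, fun x hx t ht => ?_⟩,
    fun t => ?_⟩
  · simp only [h.isPerturbedEvolution_iff]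
    exact exists_forcedTrajectory hU hX0 hX hY hφ hΦ ha T
  · simp only [h.isPerturbedEvolution_iff] at hx
    obtain ⟨h0, hd⟩ := hasDerivAt_forcedTrajectory hX0 hX' hY.continuousAt rfl hΦ ha hu0 hu hx ht
    rw [← h0] at hVd
    rw [← h0]
    exact hVd.comp_hasDerivAt (0 : ℝ) hd
  · beta_reduce
    rw [← causal_convolution_eq ha, fderiv_apply_eq_sum]
    push_cast
    simp only [hui]
    have hc : ∀ μ, Continuous fun s : ℝ => (φ s : ℂ) * freeEvolution freq e (fun l => Complex.I *
        (Real.sign (freq l) : ℂ) * star (∑ μ, e l μ * (gradient ψ V x₀ μ : ℂ))) (t - s) μ *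
          ((partialDeriv (observable ψ V) μ x₀ : ℝ) : ℂ) := by
      intro μ
      simp only [freeEvolution, Finset.sum_apply, Pi.smul_apply]
      fun_prop
    simp only [← intervalIntegral.integral_mul_const]
    rw [← intervalIntegral.integral_finsetSum fun μ _ =>
      (hc μ).intervalIntegrable _ _]
    refine intervalIntegral.integral_congr fun s _ => ?_
    have hd := dotProduct_freeEvolution freq e (gradient ψ V x₀) (t - s)
    change _ = responseFunction freq (spectralWeight freq e (gradient ψ V x₀)) (t - s) at hd
    rw [← hd, Finset.mul_sum]
    refine Finset.sum_congr rfl fun μ _ => ?_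
    simp only [gradient]
    ring

theorem RegularEquilibrium.isRetardedGreenFunction (h : RegularEquilibrium U ψ H V x₀)
    (he : IsNormalizedEigensystem (symplecticForm ψ x₀) (generator ψ H x₀) freq e) :
    IsRetardedGreenFunction U ψ H V x₀
      (greenFunction
        (continuous_responseFunction freq (spectralWeight freq e (gradient ψ V x₀)))
        (norm_responseFunction_le freq (spectralWeight freq e (gradient ψ V x₀)))) := by
  intro φ hφ hφc
  obtain ⟨δV, h1, h2⟩ := h.exists_linearResponse he hφ hφc
  refine ⟨δV, h1, fun θ η hη => ?_⟩
  simp only [h2]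
  exact integral_causal_convolution _ _ hφ hφc hη

/-- The spectral function is a sum of delta functions. -/
theorem RegularEquilibrium.isSpectralFunction_iff (h : RegularEquilibrium U ψ H V x₀)
    (he : IsNormalizedEigensystem (symplecticForm ψ x₀) (generator ψ H x₀) freq e)
    {A : 𝓢'(ℝ, ℂ)} :
    IsSpectralFunction U ψ H V x₀ A ↔
      A = diracSum freq (spectralWeight freq e (gradient ψ V x₀)) := by
  have hG := h.isRetardedGreenFunction he
  have hval : ∀ θ : 𝓢(ℝ, ℂ), (∀ w, (θ w).im = 0) →
      diracSum freq (spectralWeight freq e (gradient ψ V x₀)) θ =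
        ((-(1 / Real.pi) * (greenFunction
          (continuous_responseFunction freq (spectralWeight freq e (gradient ψ V x₀)))
          (norm_responseFunction_le freq (spectralWeight freq e (gradient ψ V x₀))) θ).im :
            ℝ) : ℂ) := by
    intro θ hθ
    have hpi := Real.pi_ne_zero
    rw [im_greenFunction (h.star_responseFunction he) hθ, diracSum_apply, neg_mul_neg,
      ← mul_assoc, one_div, inv_mul_cancel₀ hpi, one_mul]
    push_cast
    refine Finset.sum_congr rfl fun l _ => ?_
    congr 1
    exact Complex.ext rfl (by simp [hθ (freq l)])
  constructor
  · rintro ⟨G, hG', hA⟩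
    obtain rfl := hG'.unique hG
    exact temperedDistribution_ext_real fun θ hθ => by rw [hA θ hθ, hval θ hθ]
  · rintro rfl
    exact ⟨_, hG, hval⟩

end Response

/-- Minimality enters through the vanishing gradient, and constant rank through the smoothness of
`Ω`. -/
theorem regularEquilibrium_of_isLocalMin {𝓗 : Type*} [NormedAddCommGroup 𝓗]
    [InnerProductSpace ℂ 𝓗] {n : ℕ} {H V : 𝓗 →ₗ.[ℂ] 𝓗} {U : Set (Fin n → ℝ)} (hU : IsOpen U)
    {ψ : (Fin n → ℝ) → 𝓗} (hψ : ContDiffOn ℝ 2 ψ U) (hψ_ne : ∀ x ∈ U, ψ x ≠ 0)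
    (hψ_dom : ∀ x ∈ U, ψ x ∈ H.domain ∧ ψ x ∈ V.domain)
    (hψ_imm : ∀ x ∈ U, LinearIndependent ℝ (tangentVector ψ x))
    (hE : ContDiffOn ℝ 2 (observable ψ H) U) (hVobs : ContDiffOn ℝ 2 (observable ψ V) U)
    {x₀ : Fin n → ℝ} (hx₀ : x₀ ∈ U)
    (hrank : ∀ᶠ x in 𝓝 x₀, (symplecticForm ψ x).rank = (symplecticForm ψ x₀).rank)
    (hmin : IsLocalMin (observable ψ H) x₀) (hhess : (hessian (observable ψ H) x₀).PosDef) :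
    RegularEquilibrium U ψ H V x₀ := by
  have hnhds := hU.mem_nhds hx₀
  have hψx := hψ.contDiffAt hnhds
  have hne := hψ_ne x₀ hx₀
  have hg := posDef_metric hne (hψ_imm x₀ hx₀)
  have hw := transpose_symplecticForm ψ x₀
  exact
    { isOpen := hU
      mem := hx₀
      domain := hψ_dom
      energy := hE
      probe := hVobs
      inverse := (matrixContDiffAt_metric hψx hne).pseudoInverse
        (matrixContDiffAt_symplecticForm hψx hne)
        (eventually_posDef_metric hnhds hψ_ne hψ_imm) hrank
      critical := funext fun μ => by
        simp [gradient, partialDeriv, hmin.fderiv_eq_zero]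
      linearized := ⟨hhess, hw, transpose_pseudoInverse hg hw,
        (isPseudoInverse_pseudoInverse hg _).outer_inverse⟩ }

end VariationalResponse

/-! ### Assembly of the theorem. -/

theorem mainTheorem8 {𝓗 : Type*} [NormedAddCommGroup 𝓗] [InnerProductSpace ℂ 𝓗] [CompleteSpace 𝓗]
    (H V : 𝓗 →ₗ.[ℂ] 𝓗) (hH : H.IsFormalAdjoint H) (hV : V.IsFormalAdjoint V)
    (n : ℕ) (U : Set (Fin n → ℝ)) (hU : IsOpen U) (ψ : (Fin n → ℝ) → 𝓗)
    (hψ : ContDiffOn ℝ 2 ψ U)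
    (hψ_ne : ∀ x ∈ U, ψ x ≠ 0)
    (hψ_dom : ∀ x ∈ U, ψ x ∈ H.domain ∧ ψ x ∈ V.domain)
    (hψ_imm :  ∀ x ∈ U, LinearIndependent ℝ (VariationalResponse.tangentVector ψ x))
    (hE : ContDiffOn ℝ 2 (VariationalResponse.observable ψ H) U)
    (hVobs : ContDiffOn ℝ 2 (VariationalResponse.observable ψ V) U)
    (x₀ : Fin n → ℝ) (hx₀ : x₀ ∈ U)
    (hrank : ∀ᶠ x in nhds x₀, (VariationalResponse.symplecticForm ψ x).rank =
      (VariationalResponse.symplecticForm ψ x₀).rank)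
    (hmin : IsLocalMin (VariationalResponse.observable ψ H) x₀)
    (hhess : (VariationalResponse.hessian (VariationalResponse.observable ψ H) x₀).PosDef) :
    (∃ (m : ℕ) (freq : Fin m → ℝ) (e : Fin m → Fin n → ℂ), (∀ l, 0 < freq l) ∧
      VariationalResponse.IsNormalizedEigensystem (VariationalResponse.symplecticForm ψ x₀)
        (VariationalResponse.generator ψ H x₀)
        (Sum.elim freq fun l => -freq l) (Sum.elim e fun l => star (e l))) ∧
    (∃! G : 𝓢'(ℝ, ℂ), VariationalResponse.IsRetardedGreenFunction U ψ H V x₀ G) ∧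
    ∃ A : 𝓢'(ℝ, ℂ),
      (∀ A' : 𝓢'(ℝ, ℂ), VariationalResponse.IsSpectralFunction U ψ H V x₀ A' ↔ A' = A) ∧
      (∀ (ι : Type) [Fintype ι] [DecidableEq ι] (freq : ι → ℝ) (e : ι → Fin n → ℂ),
        VariationalResponse.IsNormalizedEigensystem (VariationalResponse.symplecticForm ψ x₀)
          (VariationalResponse.generator ψ H x₀) freq e →
        A = ∑ l, ((Real.sign (freq l) *
          ‖∑ μ, e l μ * (VariationalResponse.gradient ψ V x₀ μ : ℂ)‖ ^ 2 : ℝ) : ℂ) •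
            TemperedDistribution.delta (freq l)) ∧
      VariationalResponse.SignEqSignFrequency A := by
  have h := VariationalResponse.regularEquilibrium_of_isLocalMin hU hψ hψ_ne hψ_dom hψ_imm hE hVobs
    hx₀ hrank hmin hhess
  obtain ⟨m, freq, e, hpos, he⟩ := h.linearized.exists_eigensystem
  have hG := h.isRetardedGreenFunction he
  refine ⟨⟨m, freq, e, hpos, he⟩, ⟨_, hG, fun G' hG' => hG'.unique hG⟩, _,
    fun A' => h.isSpectralFunction_iff he, fun ι _ _ freq' e' he' => ?_,
    VariationalResponse.signEqSignFrequency_diracSum he.freq_ne_zero fun l => by positivity⟩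
  -- `A` is built from one eigensystem. Being the spectral function does not refer to any
  -- eigensystem, so the formula transfers to every other one.
  exact (h.isSpectralFunction_iff he').mp ((h.isSpectralFunction_iff he).mpr rfl)
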